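/- Setting. Let $N_a\ge1$, $N_e\ge1$, $N_j\ge2$ be the numbers of antennas of Alice, Eve and the jammer (uniform linear arrays); Bob has one antenna. Let $\tilde\gamma_{ab},\tilde\gamma_{ae},\tilde\gamma_{je}>0$, where $\tilde\gamma_{ab}=P_ad_{ab}^{-\eta_{ab}}/\sigma_b^2$, $\tilde\gamma_{ae}=P_ad_{ae}^{-\eta_{ae}}/\sigma_e^2$, $\tilde\gamma_{je}=P_jd_{je}^{-\eta_{je}}/\sigma_e^2$ with powers $P_a,P_j$, distances $d_{\cdot\cdot}$, path loss exponents $\eta_{\cdot\cdot}$ and noise variances $\sigma_b^2,\sigma_e^2$. The row vectors $\mathbf h_{ab}\in\mathbb C^{1\times N_a}$ (Alice–Bob channel) and $\mathbf h_{jb}\in\mathbb C^{1\times N_j}$, $\mathbf h_{jb}\ne0$ (jammer–Bob channel) are known and fixed. For $q\in\{a,j\}$ the channel to Eve is $\mathbf G_{qe}=\sqrt{\tfrac{K_{qe}}{1+K_{qe}}}\,\mathbf G^o_{qe}+\sqrt{\tfrac1{1+K_{qe}}}\,\mathbf G^r_{qe}\in\mathbb C^{N_e\times N_q}$, $K_{qe}\ge0$,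 with deterministic line-of-sight part $\mathbf G^o_{qe}=\big(e^{-2\pi \mathrm i k\delta_e\cos\phi_{qe}}\,e^{2\pi\mathrm i m\delta_q\cos\theta_{qe}}\big)_{0\le k<N_e,\,0\le m<N_q}$; all entries of $\mathbf G^r_{ae}$ and $\mathbf G^r_{je}$ are i.i.d. $\mathcal{CN}(0,1)$. The columns of $\mathbf W_{AN}\in\mathbb C^{N_j\times(N_j-1)}$ form an orthonormal basis of the null space of $\mathbf h_{jb}$. For a unit vector $\mathbf w\in\mathbb C^{N_a}$ put $\gamma_b=\tilde\gamma_{ab}|\mathbf h_{ab}\mathbf w|^2$ and, with $\kappa=\tilde\gamma_{je}/(N_j-1)$, $$\gamma_e=\tilde\gamma_{ae}\,\mathbf w^H\mathbf G_{ae}^H\mathbf M^{-1}\mathbf G_{ae}\mathbf w,\qquad \mathbf M=\kappa\,\mathbf G_{je}\mathbf W_{AN}\mathbf W_{AN}^H\mathbf G_{je}^H+\mathbf I_{N_e}.$$ Let $C_s=\log_2(1+\gamma_b)-\log_2(1+\gamma_e)$ if $\gamma_b>\gamma_e$ and $C_s=0$ otherwise, and for $R_s>0$ let $P_{\rm out}(R_s)=\Pr(C_s<R_s)$,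 the channels to Bob (hence $\gamma_b$) being given. The vector $\mathbf w$ may in particular be a location-based beamformer $\mathbf w(\tau)=\sqrt\tau\,\mathbf w_1+\sqrt{1-\tau}\,\mathbf w_2$, $\tau\in[0,1]$, where $\mathbf w_2$ and $\mathbf w_1$ are the normalized (nonzero) components of $\mathbf h_{ab}^H$ in the row space of $\mathbf G^o_{ae}$ (the range of $(\mathbf G_{ae}^o)^H$) and in its orthogonal complement; these $\mathbf w(\tau)$ are unit vectors. For $l\in\{1,2\}$ let, with $(N_e)_m=\Gamma(N_e+m)/\Gamma(N_e)$, $$\varphi_l=\frac1{(1+K_{ae})^l}\sum_{m=0}^l\binom lm\frac{(K_{ae}\|\mathbf G^o_{ae}\mathbf w\|^2)^m}{(N_e)_m},$$ $$\vartheta_l=\frac{l\,e^{1/\kappa}}{\kappa^{N_j-1}}\sum_{p=0}^{N_e-1}\rho_p\sum_{t=0}^{l-1+p}\binom{l-1+p}{t}\Big(-\frac1\kappa\Big)^{l-1+p-t}\Gamma\Big(t-N_j+2,\frac1\kappa\Big),\qquad \rho_p=\kappa^p\sum_{q=\max(0,p-N_j+1)}^{p}\binom{N_j-1}{p-q}\frac1{q!\,\kappa^q},$$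 where $\Gamma(\mu,\nu)=\int_\nu^\infty e^{-t}t^{\mu-1}dt$; and $\gamma(\mu,\nu)=\int_0^\nu e^{-t}t^{\mu-1}dt$ for $\nu\ge0$, $\gamma(\mu,\nu)=0$ for $\nu<0$. Theorem 2. Let $K_{je}=0$, let $\mathbf w$ be a unit vector and $R_s>0$. Then: (i) the first two moments of $\gamma_e$ are finite, $\mathbb E[\gamma_e^l]=\tilde\gamma_{ae}^l\varphi_l\vartheta_l$ for $l\in\{1,2\}$, and $\mathrm{Var}(\gamma_e)=\tilde\gamma_{ae}^2(\varphi_2\vartheta_2-\varphi_1^2\vartheta_1^2)$, with $\varphi_1\vartheta_1>0$ and $\varphi_2\vartheta_2-\varphi_1^2\vartheta_1^2>0$; (ii) there is exactly one gamma law with the mean and the variance of $\gamma_e$; its shape $\alpha>0$ and scale $\beta>0$ are $$\alpha=\frac{\varphi_1^2\vartheta_1^2}{\varphi_2\vartheta_2-\varphi_1^2\vartheta_1^2},\qquad \beta=\tilde\gamma_{ae}\,\frac{\varphi_2\vartheta_2-\varphi_1^2\vartheta_1^2}{\varphi_1\vartheta_1};$$ (iii) $P_{\rm out}(R_s)=\Pr\big(\gamma_e>2^{-R_s}(1+\gamma_b)-1\big)$,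 and the gamma approximation of $P_{\rm out}(R_s)$, i.e. the value of $\Pr(C_s<R_s)$ when $\gamma_e$ is replaced by a random variable with the gamma law of (ii), is $$1-\frac{\gamma\Big(\alpha,\frac{2^{-R_s}(1+\gamma_b)-1}{\beta}\Big)}{\Gamma(\alpha)}.$$ -/

import Mathlib

open MeasureTheory ProbabilityTheory Set
open scoped Matrix

noncomputable section

/-- The standard complex Gaussian law `𝒞𝒩(0,1)`: independent real and imaginary parts,
each centred Gaussian with variance `1/2`. -/
def stdComplexGaussian : Measure ℂ :=
  ((gaussianReal 0 (1 / 2)).prod (gaussianReal 0 (1 / 2))).map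
    Complex.measurableEquivRealProd.symm

/-- Lower incomplete gamma function `∫_0^ν e^{-t} t^{μ-1} dt` (equal to `0` for `ν ≤ 0`). -/
def lowerIncGamma (μ ν : ℝ) : ℝ := ∫ t in Ioc 0 ν, Real.exp (-t) * t ^ (μ - 1)

/-- Upper incomplete gamma function `∫_ν^∞ e^{-t} t^{μ-1} dt`. -/
def upperIncGamma (μ ν : ℝ) : ℝ := ∫ t in Ioi ν, Real.exp (-t) * t ^ (μ - 1)

/-- Achievable secrecy rate for SINRs `γb` at Bob and `γe` at Eve. -/
def secrecyRate (γb γe : ℝ) : ℝ :=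
  if γe < γb then Real.logb 2 (1 + γb) - Real.logb 2 (1 + γe) else 0

/-- Response vector of a uniform linear array of `n` antennas with spacing `δ` (in wavelengths)
in the direction `θ`: the `k`-th entry is `exp (2π j k δ cos θ)`, `k = 0, …, n - 1`. -/
def arrayResponse (n : ℕ) (δ θ : ℝ) : Fin n → ℂ :=
  fun k => Complex.exp (2 * Real.pi * Complex.I * (k : ℂ) * δ * Real.cos θ)

/-- Line-of-sight matrix (rank one, `receiver × transmitter`) between a transmitting array with
spacing `δt` and departure angle `θ`, and a receiving array with spacing `δr` and arrival angle
`φ`; the receive response has entries `exp (-2π j k δr cos φ)`. -/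
def losMatrix (Nr Nt : ℕ) (δr φ δt θ : ℝ) : Matrix (Fin Nr) (Fin Nt) ℂ :=
  Matrix.vecMulVec (star (arrayResponse Nr δr φ)) (arrayResponse Nt δt θ)

/-- Rician channel matrix with `K`-factor `K`, line-of-sight part `Go` and scattered part `Gr`. -/
def ricianMatrix {m n : ℕ} (K : ℝ) (Go Gr : Matrix (Fin m) (Fin n) ℂ) :
    Matrix (Fin m) (Fin n) ℂ :=
  (Real.sqrt (K / (1 + K)) : ℂ) • Go + (Real.sqrt (1 / (1 + K)) : ℂ) • Gr

/-- The deterministic data of a wiretap channel with a jammer: transmitter Alice (`Na` antennas),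
single-antenna receiver Bob, jammer J (`Nj` antennas), eavesdropper Eve (`Ne` antennas).
The channels to Bob are known at the transmitters and enter through their realizations. -/
structure WiretapChannel (Na Nj Ne : ℕ) where
  /-- transmit power at Alice -/
  Pa : ℝ
  /-- transmit power at the jammer -/
  Pj : ℝ
  /-- distance Alice to Bob -/
  dab : ℝ
  /-- distance Alice to Eve -/
  dae : ℝ
  /-- distance jammer to Eve -/
  dje : ℝ
  /-- path loss exponent Alice to Bob -/
  ηab : ℝ
  /-- path loss exponent Alice to Eve -/
  ηae : ℝ
  /-- path loss exponent jammer to Eve -/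
  ηje : ℝ
  /-- standard deviation of the noise at Bob -/
  σb : ℝ
  /-- standard deviation of the noise at Eve -/
  σe : ℝ
  /-- Rician factor Alice to Eve -/
  Kae : ℝ
  /-- Rician factor jammer to Eve -/
  Kje : ℝ
  /-- antenna spacing at Alice -/
  δa : ℝ
  /-- antenna spacing at the jammer -/
  δj : ℝ
  /-- antenna spacing at Eve -/
  δe : ℝ
  /-- angle from Alice to Eve -/
  θae : ℝ
  /-- angle from the jammer to Eve -/
  θje : ℝ
  /-- angle of arrival at Eve of Alice's signal -/
  φae : ℝ
  /-- angle of arrival at Eve of the jammer's signal -/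
  φje : ℝ
  /-- realization of the (row) channel vector Alice to Bob -/
  hab : Fin Na → ℂ
  /-- realization of the (row) channel vector jammer to Bob -/
  hjb : Fin Nj → ℂ
  /-- beamforming matrix of the jamming signal -/
  WAN : Matrix (Fin Nj) (Fin (Nj - 1)) ℂ
  Pa_pos : 0 < Pa
  Pj_pos : 0 < Pj
  dab_pos : 0 < dab
  dae_pos : 0 < dae
  dje_pos : 0 < dje
  σb_pos : 0 < σb
  σe_pos : 0 < σe
  Kae_nonneg : 0 ≤ Kae
  Kje_nonneg : 0 ≤ Kje
  /-- the columns of `WAN` are orthonormal -/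
  WAN_orthonormal : WANᴴ * WAN = 1
  /-- the columns of `WAN` span the null space of `hjb` -/
  WAN_range : ∀ v : Fin Nj → ℂ, hjb ⬝ᵥ v = 0 ↔ ∃ t, WAN *ᵥ t = v

namespace WiretapChannel

variable {Na Nj Ne : ℕ} (C : WiretapChannel Na Nj Ne)

/-- `γ̃_ab` -/
def snrAB : ℝ := C.Pa * C.dab ^ (-C.ηab) / C.σb ^ 2

/-- `γ̃_ae` -/
def snrAE : ℝ := C.Pa * C.dae ^ (-C.ηae) / C.σe ^ 2

/-- `γ̃_je` -/
def snrJE : ℝ := C.Pj * C.dje ^ (-C.ηje) / C.σe ^ 2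

/-- `κ = γ̃_je / (Nj - 1)` -/
def kappa : ℝ := C.snrJE / ((Nj : ℝ) - 1)

/-- Line-of-sight component of the Alice-Eve channel. -/
def Gaeo : Matrix (Fin Ne) (Fin Na) ℂ := losMatrix Ne Na C.δe C.φae C.δa C.θae

/-- Line-of-sight component of the jammer-Eve channel. -/
def Gjeo : Matrix (Fin Ne) (Fin Nj) ℂ := losMatrix Ne Nj C.δe C.φje C.δj C.θje

/-- Interference-plus-noise matrix at Eve, for the scattered part `Gjer` of the jammer-Eve
channel. -/
def M (Gjer : Matrix (Fin Ne) (Fin Nj) ℂ) : Matrix (Fin Ne) (Fin Ne) ℂ :=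
  (C.kappa : ℂ) • (ricianMatrix C.Kje C.Gjeo Gjer * C.WAN * C.WANᴴ *
    (ricianMatrix C.Kje C.Gjeo Gjer)ᴴ) + 1

/-- SINR at Bob for the beamforming vector `w`. -/
def gammaB (w : EuclideanSpace ℂ (Fin Na)) : ℝ := C.snrAB * ‖C.hab ⬝ᵥ w.ofLp‖ ^ 2

/-- SINR at Eve after MMSE combining, for the scattered parts `Gaer`, `Gjer` of her two channels:
`γ̃_ae (G w)ᴴ M⁻¹ (G w)` (a real number, since `M` is positive definite). -/
def gammaE (w : EuclideanSpace ℂ (Fin Na)) (Gaer : Matrix (Fin Ne) (Fin Na) ℂ)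
    (Gjer : Matrix (Fin Ne) (Fin Nj) ℂ) : ℝ :=
  C.snrAE * (star (ricianMatrix C.Kae C.Gaeo Gaer *ᵥ w.ofLp) ⬝ᵥ
    ((C.M Gjer)⁻¹ *ᵥ (ricianMatrix C.Kae C.Gaeo Gaer *ᵥ w.ofLp))).re

/-- `hᴴ` for the Alice-Bob channel `h`. -/
def habH : EuclideanSpace ℂ (Fin Na) := WithLp.toLp 2 (star C.hab)

/-- Row space of the line-of-sight matrix `G` of the Alice-Eve channel, i.e. the range of `Gᴴ`.
The orthogonal projection onto it is `Gᴴ (G Gᴴ)⁻¹ G` (with a pseudo-inverse when `G Gᴴ` is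
singular). -/
def losSpace : Submodule ℂ (EuclideanSpace ℂ (Fin Na)) :=
  LinearMap.range (Matrix.toEuclideanLin C.Gaeoᴴ)

/-- `Ψ^⊥ hᴴ`: the component of `hᴴ` orthogonal to the line-of-sight direction. -/
def nullComponent : EuclideanSpace ℂ (Fin Na) := C.losSpaceᗮ.starProjection C.habH

/-- `Ψ hᴴ`: the component of `hᴴ` along the line-of-sight direction. -/
def losComponent : EuclideanSpace ℂ (Fin Na) := C.losSpace.starProjection C.habH

/-- The location-based beamformer `w(τ) = √τ w₁ + √(1-τ) w₂`, with `w₁`, `w₂` the normalizations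
of `Ψ^⊥ hᴴ` and `Ψ hᴴ`. -/
def beamformer (τ : ℝ) : EuclideanSpace ℂ (Fin Na) :=
  (Real.sqrt τ : ℂ) • (((‖C.nullComponent‖⁻¹ : ℝ) : ℂ) • C.nullComponent) +
    (Real.sqrt (1 - τ) : ℂ) • (((‖C.losComponent‖⁻¹ : ℝ) : ℂ) • C.losComponent)

/-- `φ_l`, with `(Ne)_m = Γ(Ne + m) / Γ(Ne)`. -/
def phi (w : EuclideanSpace ℂ (Fin Na)) (l : ℕ) : ℝ :=
  1 / (1 + C.Kae) ^ l * ∑ m ∈ Finset.range (l + 1), (l.choose m : ℝ) *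
    (C.Kae * ‖WithLp.toLp 2 (C.Gaeo *ᵥ w.ofLp)‖ ^ 2) ^ m /
      (Real.Gamma ((Ne : ℝ) + m) / Real.Gamma Ne)

/-- `ρ_p`; the lower limit of summation is `max 0 (p - (Nj - 1))`. -/
def rho (p : ℕ) : ℝ :=
  C.kappa ^ p * ∑ q ∈ Finset.Icc (p - (Nj - 1)) p,
    ((Nj - 1).choose (p - q) : ℝ) * (1 / ((q.factorial : ℝ) * C.kappa ^ q))

/-- `ϑ_l` (for `l ≥ 1`). -/
def vartheta (l : ℕ) : ℝ :=
  (l : ℝ) * Real.exp (1 / C.kappa) / C.kappa ^ (Nj - 1) *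
    ∑ p ∈ Finset.range Ne, C.rho p *
      ∑ t ∈ Finset.range (l - 1 + p + 1), ((l - 1 + p).choose t : ℝ) *
        (-(1 / C.kappa)) ^ (l - 1 + p - t) *
          upperIncGamma ((t : ℝ) - (Nj : ℝ) + 2) (1 / C.kappa)

/-- Shape parameter of the approximating gamma law. -/
def alpha (w : EuclideanSpace ℂ (Fin Na)) : ℝ :=
  (C.phi w 1 ^ 2 * C.vartheta 1 ^ 2) /
    (C.phi w 2 * C.vartheta 2 - C.phi w 1 ^ 2 * C.vartheta 1 ^ 2)

/-- Scale parameter of the approximating gamma law. -/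
def beta (w : EuclideanSpace ℂ (Fin Na)) : ℝ :=
  C.snrAE * ((C.phi w 2 * C.vartheta 2 - C.phi w 1 ^ 2 * C.vartheta 1 ^ 2) /
    (C.phi w 1 * C.vartheta 1))

end WiretapChannel

/-- The gamma law with shape `a` and scale `b` (density `x^{a-1} e^{-x/b} / (Γ(a) b^a)` on
`x > 0`). -/
def gammaLaw (a b : ℝ) : Measure ℝ := gammaMeasure a b⁻¹

/-- The gamma law with shape `a` and scale `b` has the mean and the variance of `X`. -/
def GammaMatches {Ω : Type*} [MeasurableSpace Ω] (a b : ℝ) (X : Ω → ℝ) (P : Measure Ω) : Prop :=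
  ∫ x, x ∂(gammaLaw a b) = ∫ ω, X ω ∂P ∧
    variance (fun x : ℝ => x) (gammaLaw a b) = variance X P

/-- The secrecy outage probability `Pr(C_s < R_s)` given Bob's SINR `γb`, when Eve's SINR is the
random variable `X`. -/
def secrecyOutage {Ω : Type*} [MeasurableSpace Ω] (γb Rs : ℝ) (X : Ω → ℝ) (P : Measure Ω) : ℝ :=
  P.real {ω | secrecyRate γb (X ω) < Rs}

end

/-!
The moments of Eve's SINR `γ̃_ae xᴴ M⁻¹ x` factor. Here `x = G_ae w` is a noncentral complex
Gaussian vector, and `M = 1 + κ ∑ⱼ hⱼ hⱼᴴ`, where the `N = Nj - 1` vectors `hⱼ` are the columns of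
`G_je W_AN`. Complex Gaussian laws are invariant under matrices with orthonormal rows
(`measurePreserving_mulVec`), so the `hⱼ` are independent standard complex Gaussian vectors,
independent of `x` (`hasLaw_signal_jamming`), and for fixed `x` the law of `xᴴ M⁻¹ x` is that of
`‖x‖² V`, where `V` is a diagonal entry of `M⁻¹` (`lintegral_quadratic_inv_eq`). Hence the `l`-th
moment is `γ̃_ae^l E‖x‖^{2l} E V^l`. The moments of `‖x‖²` give `φ_l` times the rising factorial
`(Ne)_l` (`phi_one`, `phi_two`).

The moment `E V^l` is computed by applying the same factorization to a *central* vector `z` in place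
of `x`: then `E ‖z‖^{2l} E V^l` is the `l`-th moment of `zᴴ M⁻¹ z`, whose density is explicit.
Substituting `z = M^{1/2} u` (`lintegral_quadratic_inv`) turns the quadratic form into `‖u‖²`, at
the price of the weight `det M · exp (-κ ∑ⱼ |uᴴ hⱼ|²)`. For fixed `u` the expectation of this weight
over the `hⱼ` reduces, after rotating `u` to a coordinate axis and rescaling that coordinate, to expected
determinants of interference matrices (`lintegral_det_mul_exp`). In dimension `n` such an expected
determinant is `n! ρ_n`, where `ρ_n` is the `n`-th Taylor coefficient of `e^x (1 + κ x)^N`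
(`lintegral_det_interference`), by induction on `N` with the matrix determinant lemma. Since
`‖u‖²` has a gamma law, the density follows (`lintegral_lintegral_quadratic_inv`). It is minus the
derivative of the tail `e^{-r} (1 + κ r)^{-N} ∑_{p < Ne} ρ_p r^p`, by the differential equation of
`e^x (1 + κ x)^N` on coefficients (`hasDerivAt_quadraticTail`), and integration by parts identifies
its `l`-th moment with `ϑ_l` (`lintegral_pow_eq_vartheta`).

The variance of the SINR is positive since `‖x‖²` has positive variance. The statements on gamma
laws follow from their mean and variance (`gammaMatches_iff`) and their distribution function
(`cdf_gammaLaw`), and those on outage from the monotonicity of the secrecy rate in Eve's SINR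
(`secrecyRate_lt_iff`).
-/

noncomputable section

/-! ### Complex Gaussian vectors -/

instance : IsProbabilityMeasure stdComplexGaussian := by
  unfold stdComplexGaussian
  exact Measure.isProbabilityMeasure_map (by fun_prop)

/-- The law of a vector of independent `𝒞𝒩(0,1)` variables. -/
def cGaussian (ι : Type*) [Fintype ι] : Measure (ι → ℂ) :=
  Measure.pi fun _ => stdComplexGaussian

instance (ι : Type*) [Fintype ι] : IsProbabilityMeasure (cGaussian ι) := by
  unfold cGaussian; infer_instance

/-- The real linear form `L` is real Gaussian with variance `(L(1)² + L(i)²) / 2`. -/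
lemma charFunDual_stdComplexGaussian (L : StrongDual ℝ ℂ) :
    charFunDual stdComplexGaussian L =
      Complex.exp (-((L 1 ^ 2 + L Complex.I ^ 2 : ℝ) : ℂ) / 4) := by
  have hL : ∀ z : ℂ, L z = L 1 * z.re + L Complex.I * z.im := fun z => by
    conv_lhs => rw [← Complex.re_add_im z]
    rw [map_add, show (z.re : ℂ) = z.re • (1 : ℂ) by simp,
      show (z.im : ℂ) * Complex.I = z.im • Complex.I by simp, map_smul, map_smul]
    simp [mul_comm]
  rw [charFunDual_apply, stdComplexGaussian, integral_map_equiv]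
  have h : ∀ p : ℝ × ℝ, Complex.exp (L (Complex.measurableEquivRealProd.symm p) * Complex.I) =
      Complex.exp ((L 1 : ℝ) * p.1 * Complex.I) *
        Complex.exp ((L Complex.I : ℝ) * p.2 * Complex.I) := fun p => by
    rw [hL, ← Complex.exp_add]
    simp [Complex.measurableEquivRealProd_symm_apply]
    ring_nf
  simp_rw [h]
  rw [integral_prod_mul (fun x : ℝ => Complex.exp ((L 1 : ℝ) * x * Complex.I))
    (fun x : ℝ => Complex.exp ((L Complex.I : ℝ) * x * Complex.I)),
    ← charFun_apply_real, ← charFun_apply_real, charFun_gaussianReal, charFun_gaussianReal,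
    ← Complex.exp_add]
  congr 1
  push_cast
  simp
  ring

lemma charFunDual_cGaussian {ι : Type*} [Fintype ι] [DecidableEq ι] (L : StrongDual ℝ (ι → ℂ)) :
    charFunDual (cGaussian ι) L = Complex.exp
      (-((∑ i, (L (Pi.single i 1) ^ 2 + L (Pi.single i Complex.I) ^ 2) : ℝ) : ℂ) / 4) := by
  rw [cGaussian, charFunDual_pi]
  simp_rw [charFunDual_stdComplexGaussian]
  rw [← Complex.exp_sum]
  congr 1
  push_cast
  simp only [neg_div, Finset.sum_neg_distrib, Finset.sum_div]
  rfl

/-- Twice the variance of `Re (l ⬝ᵥ z)` is the squared norm of `l`: the identity behind the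
unitary invariance of the complex Gaussian law. -/
lemma sum_re_sq_dotProduct_single {ι : Type*} [Fintype ι] [DecidableEq ι] (l : ι → ℂ) :
    ∑ i, ((l ⬝ᵥ Pi.single i 1).re ^ 2 + (l ⬝ᵥ Pi.single i Complex.I).re ^ 2) =
      (l ⬝ᵥ star l).re := by
  simp only [dotProduct_single]
  simp [dotProduct, Complex.re_sum, pow_two]

/-- Invariance of the complex Gaussian law: a matrix with orthonormal rows maps a standard
complex Gaussian vector to a standard complex Gaussian vector. -/
theorem measurePreserving_mulVec {ι κ : Type*} [Fintype ι] [Fintype κ] [DecidableEq ι]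
    [DecidableEq κ] (A : Matrix κ ι ℂ) (hA : A * Aᴴ = 1) :
    MeasurePreserving (fun z => A *ᵥ z) (cGaussian ι) (cGaussian κ) := by
  refine ⟨by fun_prop, ?_⟩
  set T : (ι → ℂ) →L[ℝ] (κ → ℂ) :=
    LinearMap.toContinuousLinearMap ((Matrix.mulVecLin A).restrictScalars ℝ)
  have hT : ∀ z, T z = A *ᵥ z := fun z => rfl
  change (cGaussian ι).map T = _
  have : IsProbabilityMeasure ((cGaussian ι).map T) :=
    Measure.isProbabilityMeasure_map (by fun_prop)
  refine Measure.ext_of_charFunDual (funext fun L => ?_)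
  rw [charFunDual_map, charFunDual_cGaussian, charFunDual_cGaussian]
  congr 4
  -- a real linear form is `z ↦ Re (l ⬝ᵥ z)`
  set l : κ → ℂ := fun k => ⟨L (Pi.single k 1), -L (Pi.single k Complex.I)⟩ with hl
  have hL : ∀ z, L z = (l ⬝ᵥ z).re := fun z => by
    conv_lhs => rw [← Finset.univ_sum_single z]
    rw [map_sum, dotProduct, Complex.re_sum]
    refine Finset.sum_congr rfl fun k _ => ?_
    have : (Pi.single k (z k) : κ → ℂ) =
        (z k).re • (Pi.single k 1 : κ → ℂ) + (z k).im • (Pi.single k Complex.I : κ → ℂ) := by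
      rw [← Pi.single_smul, ← Pi.single_smul, ← Pi.single_add]
      simp
    rw [this, map_add, map_smul, map_smul]
    simp [hl, mul_comm]
  have h1 : ∀ z, (L.comp T) z = ((l ᵥ* A) ⬝ᵥ z).re := fun z => by
    rw [ContinuousLinearMap.comp_apply, hT, hL, Matrix.dotProduct_mulVec]
  simp_rw [h1, hL]
  rw [sum_re_sq_dotProduct_single, sum_re_sq_dotProduct_single, Matrix.star_vecMul,
    ← Matrix.dotProduct_mulVec, Matrix.mulVec_mulVec, hA, Matrix.one_mulVec]

/-- Tonelli's theorem for a product of functions of one coordinate each. -/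
theorem lintegral_pi_prod {n : ℕ} {X : Type*} [MeasurableSpace X] (μ : Measure X)
    [SigmaFinite μ] (w : Fin n → X → ENNReal) (hw : ∀ i, Measurable (w i)) :
    ∫⁻ x : Fin n → X, ∏ i, w i (x i) ∂(Measure.pi fun _ => μ) = ∏ i, ∫⁻ x, w i x ∂μ := by
  induction n with
  | zero => simp
  | succ n ih =>
    rw [← (measurePreserving_piFinSuccAbove (fun _ : Fin (n + 1) => μ) 0).symm.lintegral_comp_emb
      (MeasurableEquiv.measurableEmbedding _)]
    simp_rw [MeasurableEquiv.piFinSuccAbove_symm_apply, Fin.insertNthEquiv,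
      Fin.prod_univ_succ, Fin.insertNth_zero, Equiv.coe_fn_mk, Fin.cons_succ, Fin.cons_zero]
    simp only [cast_eq]
    refine (lintegral_prod_mul (μ := μ) (ν := Measure.pi fun _ : Fin n => μ) (f := w 0)
      (g := fun x : Fin n → X => ∏ i, w i.succ (x i)) (hw 0).aemeasurable
      (Finset.measurable_prod _
        fun i _ => (hw _).comp (measurable_pi_apply i)).aemeasurable).trans ?_
    rw [ih (fun i => w i.succ) fun i => hw _]

/-- A product of measures with densities has the product density. -/
theorem pi_withDensity (n : ℕ) {X : Type*} [MeasurableSpace X] (μ : Measure X) [SigmaFinite μ]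
    (w : X → ENNReal) (hw : Measurable w) [SigmaFinite (μ.withDensity w)] :
    Measure.pi (fun _ : Fin n => μ.withDensity w) =
      (Measure.pi fun _ => μ).withDensity fun x => ∏ i, w (x i) := by
  refine Measure.pi_eq fun s hs => ?_
  rw [withDensity_apply _ (MeasurableSet.univ_pi hs)]
  have h : ∀ x : Fin n → X, (univ.pi s).indicator (fun x => ∏ i, w (x i)) x =
      ∏ i, (s i).indicator w (x i) := fun x => by
    by_cases hx : x ∈ univ.pi s
    · rw [indicator_of_mem hx]
      exact Finset.prod_congr rfl fun i _ => (indicator_of_mem (hx i trivial) _).symm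
    · rw [indicator_of_notMem hx]
      obtain ⟨i, hi⟩ : ∃ i, x i ∉ s i := by simpa using hx
      exact (Finset.prod_eq_zero (Finset.mem_univ i) (indicator_of_notMem hi _)).symm
  rw [← lintegral_indicator (MeasurableSet.univ_pi hs)]
  simp_rw [h]
  rw [lintegral_pi_prod μ _ fun i => hw.indicator (hs i)]
  exact Finset.prod_congr rfl fun i _ => by
    rw [lintegral_indicator (hs i), withDensity_apply _ (hs i)]

/-- The squared Euclidean norm of a complex vector. -/
def sqNorm {ι : Type*} [Fintype ι] (z : ι → ℂ) : ℝ := ∑ i, ‖z i‖ ^ 2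

lemma stdComplexGaussian_eq_withDensity : stdComplexGaussian =
    volume.withDensity fun z : ℂ => ENNReal.ofReal (Real.pi⁻¹ * Real.exp (-‖z‖ ^ 2)) := by
  have h2 : (1 / 2 : NNReal) ≠ 0 := by norm_num
  rw [stdComplexGaussian, gaussianReal_of_var_ne_zero _ h2,
    prod_withDensity (measurable_gaussianPDF _ _) (measurable_gaussianPDF _ _)]
  ext s hs
  rw [Measure.map_apply (by fun_prop) hs, withDensity_apply _ hs, withDensity_apply _
    (Complex.measurableEquivRealProd.symm.measurable hs),
    ← Complex.volume_preserving_equiv_real_prod.symm.setLIntegral_comp_preimage_emb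
      (MeasurableEquiv.measurableEmbedding _)]
  refine lintegral_congr fun p => ?_
  simp only [gaussianPDF, gaussianPDFReal]
  rw [← ENNReal.ofReal_mul (by positivity)]
  congr 1
  rw [← Complex.normSq_eq_norm_sq]
  simp only [Complex.normSq_apply, Complex.measurableEquivRealProd_symm_apply]
  have h : (√(2 * Real.pi * ((1 / 2 : NNReal) : ℝ)))⁻¹ * (√(2 * Real.pi * ((1 / 2 : NNReal) : ℝ)))⁻¹
      = Real.pi⁻¹ := by
    rw [← mul_inv, Real.mul_self_sqrt (by positivity)]
    congr 1
    push_cast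
    ring
  rw [mul_mul_mul_comm, h, ← Real.exp_add]
  congr 2
  push_cast
  ring

lemma cGaussian_eq_withDensity (n : ℕ) : cGaussian (Fin n) =
    volume.withDensity fun z : Fin n → ℂ =>
      ENNReal.ofReal (Real.pi⁻¹ ^ n * Real.exp (-sqNorm z)) := by
  have h := stdComplexGaussian_eq_withDensity
  have : SigmaFinite (volume.withDensity fun z : ℂ =>
      ENNReal.ofReal (Real.pi⁻¹ * Real.exp (-‖z‖ ^ 2))) := by rw [← h]; infer_instance
  rw [cGaussian, h, pi_withDensity _ _ _ (by fun_prop), volume_pi]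
  congr 1 with z
  rw [← ENNReal.ofReal_prod_of_nonneg fun _ _ => by positivity, Finset.prod_mul_distrib,
    ← Real.exp_sum]
  simp [sqNorm]

lemma measurable_sqNorm {ι : Type*} [Fintype ι] : Measurable (sqNorm : (ι → ℂ) → ℝ) := by
  unfold sqNorm; fun_prop

lemma sqNorm_nonneg {ι : Type*} [Fintype ι] (z : ι → ℂ) : 0 ≤ sqNorm z :=
  Finset.sum_nonneg fun _ _ => by positivity

lemma star_dotProduct_self {ι : Type*} [Fintype ι] (z : ι → ℂ) : star z ⬝ᵥ z = (sqNorm z : ℂ) := by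
  simp [sqNorm, dotProduct, Complex.conj_mul']

/-- As a real-linear map, a complex matrix has determinant `|det A|²`. -/
lemma lintegral_comp_mulVec_volume {n : ℕ} (A : Matrix (Fin n) (Fin n) ℂ) (hA : A.det ≠ 0)
    {g : (Fin n → ℂ) → ENNReal} (hg : Measurable g) :
    ∫⁻ x, g (A *ᵥ x) = ENNReal.ofReal ((‖A.det‖ ^ 2)⁻¹) * ∫⁻ u, g u := by
  set T : (Fin n → ℂ) →ₗ[ℝ] (Fin n → ℂ) := (Matrix.toLin' A).restrictScalars ℝ
  have hdet : LinearMap.det T = ‖A.det‖ ^ 2 := by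
    rw [LinearMap.det_restrictScalars, LinearMap.det_toLin', Algebra.norm_complex_eq]
    exact Complex.normSq_eq_norm_sq _
  have h := Measure.map_linearMap_addHaar_eq_smul_addHaar (volume : Measure (Fin n → ℂ)) (f := T)
    (by rw [hdet]; positivity)
  have h' : ∫⁻ x, g (A *ᵥ x) = ∫⁻ u, g u ∂(volume.map T) :=
    (lintegral_map hg (by exact (LinearMap.continuous_of_finiteDimensional T).measurable)).symm
  rw [h', h, lintegral_smul_measure, hdet, abs_of_nonneg (by positivity), smul_eq_mul]

/-- Linear change of variables in a complex Gaussian integral; `B` is the inverse of `A`. -/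
theorem lintegral_comp_mulVec {n : ℕ} (A B : Matrix (Fin n) (Fin n) ℂ) (hAB : A * B = 1)
    {f : (Fin n → ℂ) → ENNReal} (hf : Measurable f) :
    ∫⁻ x, f (A *ᵥ x) ∂(cGaussian (Fin n)) = ENNReal.ofReal (‖B.det‖ ^ 2) *
      ∫⁻ u, f u * ENNReal.ofReal (Real.exp (sqNorm u - sqNorm (B *ᵥ u)))
        ∂(cGaussian (Fin n)) := by
  have hdet : A.det * B.det = 1 := by rw [← Matrix.det_mul, hAB, Matrix.det_one]
  have hBA : B * A = 1 := mul_eq_one_comm.mp hAB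
  have hw : Measurable fun z : Fin n → ℂ =>
      ENNReal.ofReal (Real.pi⁻¹ ^ n * Real.exp (-sqNorm z)) := by
    have := measurable_sqNorm (ι := Fin n)
    fun_prop
  have hB : Measurable fun z : Fin n → ℂ => B *ᵥ z := by fun_prop
  have hs : Measurable fun z : Fin n → ℂ =>
      ENNReal.ofReal (Real.exp (sqNorm z - sqNorm (B *ᵥ z))) := by
    have := measurable_sqNorm (ι := Fin n)
    have := this.comp hB
    fun_prop
  rw [cGaussian_eq_withDensity, lintegral_withDensity_eq_lintegral_mul _ hw (by fun_prop),
    lintegral_withDensity_eq_lintegral_mul _ hw (by fun_prop)]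
  have h := lintegral_comp_mulVec_volume A (left_ne_zero_of_mul_eq_one hdet)
    (g := fun u => ENNReal.ofReal (Real.pi⁻¹ ^ n * Real.exp (-sqNorm (B *ᵥ u))) * f u)
    ((hw.comp hB).mul hf)
  simp only [Matrix.mulVec_mulVec, hBA, Matrix.one_mulVec] at h
  simp only [Pi.mul_apply]
  rw [h]
  congr 2
  · rw [← inv_pow, ← norm_inv, eq_inv_of_mul_eq_one_right hdet]
  · funext u
    rw [mul_comm (f u), ← mul_assoc, ← ENNReal.ofReal_mul (by positivity), mul_assoc,
      ← Real.exp_add]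
    ring_nf

/-! ### The squared norm of a complex Gaussian vector -/

lemma sqNorm_eq_norm_toLp {ι : Type*} [Fintype ι] (z : ι → ℂ) :
    sqNorm z = ‖(WithLp.toLp 2 z : EuclideanSpace ℂ ι)‖ ^ 2 := by
  rw [EuclideanSpace.norm_sq_eq]
  rfl

lemma integrable_pow_mul_exp_neg (m : ℕ) :
    IntegrableOn (fun r : ℝ => r ^ m * Real.exp (-r)) (Ioi 0) := by
  have := Real.GammaIntegral_convergent (s := m + 1) (by positivity)
  refine this.congr_fun (fun r _ => ?_) measurableSet_Ioi
  simp [mul_comm]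

lemma integral_pow_mul_exp_neg (m : ℕ) :
    ∫ r in Ioi (0 : ℝ), r ^ m * Real.exp (-r) = m.factorial := by
  rw [← Real.Gamma_nat_eq_factorial, Real.Gamma_eq_integral (by positivity)]
  refine setIntegral_congr_fun measurableSet_Ioi fun r _ => ?_
  simp [mul_comm]

/-- Polar coordinates, up to a constant independent of the radial function. -/
lemma exists_integral_comp_sqNorm (n : ℕ) : ∃ c : ℝ, ∀ f : ℝ → ℝ,
    ∫ z : Fin (n + 1) → ℂ, f (sqNorm z) = c * ∫ r in Ioi (0 : ℝ), r ^ n * f r := by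
  let E := EuclideanSpace ℂ (Fin (n + 1))
  let e : (Fin (n + 1) → ℂ) ≃L[ℝ] E :=
    (PiLp.continuousLinearEquiv 2 ℝ (fun _ : Fin (n + 1) => ℂ)).symm
  let ν : Measure E := (volume : Measure (Fin (n + 1) → ℂ)).map e
  have : ν.IsAddHaarMeasure := e.isAddHaarMeasure_map _
  have hdim : Module.finrank ℝ E = 2 * (n + 1) := by
    rw [← e.toLinearEquiv.finrank_eq, Module.finrank_pi_fintype]
    simp [Complex.finrank_real_complex, mul_comm]
  have : Nontrivial E := Module.nontrivial_of_finrank_pos (R := ℝ) (by rw [hdim]; omega)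
  refine ⟨Module.finrank ℝ E * ν.real (Metric.ball 0 1) * 2⁻¹, fun f => ?_⟩
  have h1 : ∫ z : Fin (n + 1) → ℂ, f (sqNorm z) = ∫ x : E, f (‖x‖ ^ 2) ∂ν := by
    rw [show ν = (volume : Measure (Fin (n + 1) → ℂ)).map
      e.toHomeomorph.toMeasurableEquiv from rfl, integral_map_equiv]
    refine integral_congr_ae (ae_of_all _ fun z => ?_)
    simp only [sqNorm_eq_norm_toLp]
    rfl
  rw [h1, integral_fun_norm_addHaar ν fun y => f (y ^ 2),
    ← integral_comp_rpow_Ioi_of_pos (g := fun r => r ^ n * f r) (p := 2) two_pos, hdim]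
  simp only [nsmul_eq_mul, smul_eq_mul]
  rw [mul_assoc, mul_assoc, ← integral_const_mul (2⁻¹ : ℝ)]
  congr 2
  refine setIntegral_congr_fun measurableSet_Ioi fun y hy => ?_
  have : y ^ ((2 : ℝ) - 1) = y := by norm_num
  simp only [this, Real.rpow_two]
  rw [show 2 * (n + 1) - 1 = 2 * n + 1 by omega]
  ring

/-- The squared norm of a standard complex Gaussian vector in `ℂ^{n+1}` has the gamma law with
shape `n + 1` and scale `1`. -/
theorem lintegral_comp_sqNorm (n : ℕ) {f : ℝ → ENNReal} (hf : Measurable f) :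
    ∫⁻ z, f (sqNorm z) ∂(cGaussian (Fin (n + 1))) =
      ∫⁻ r in Ioi 0, f r * ENNReal.ofReal (r ^ n * Real.exp (-r) / n.factorial) := by
  have hw : Measurable fun r : ℝ => ENNReal.ofReal (r ^ n * Real.exp (-r) / n.factorial) := by
    fun_prop
  obtain ⟨c, hc⟩ := exists_integral_comp_sqNorm n
  -- The constant `c` is not computed: it is determined by the total mass of the Gaussian law.
  have key : ∀ g : ℝ → ℝ, ∫ z, g (sqNorm z) ∂(cGaussian (Fin (n + 1))) =
      (Real.pi⁻¹ ^ (n + 1) * c) * ∫ r in Ioi (0 : ℝ), r ^ n * Real.exp (-r) * g r := fun g => by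
    have hd : Measurable fun z : Fin (n + 1) → ℂ =>
        (Real.pi⁻¹ ^ (n + 1) * Real.exp (-sqNorm z)).toNNReal := by
      have := measurable_sqNorm (ι := Fin (n + 1))
      fun_prop
    rw [cGaussian_eq_withDensity]
    have h1 := integral_withDensity_eq_integral_smul (μ := (volume : Measure (Fin (n + 1) → ℂ)))
      hd fun z => g (sqNorm z)
    have h2 : ∀ z : Fin (n + 1) → ℂ, (Real.pi⁻¹ ^ (n + 1) * Real.exp (-sqNorm z)).toNNReal •
        g (sqNorm z) = Real.pi⁻¹ ^ (n + 1) * (Real.exp (-sqNorm z) * g (sqNorm z)) := fun z => by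
      rw [NNReal.smul_def, Real.coe_toNNReal _ (by positivity), smul_eq_mul, mul_assoc]
    simp only [h2] at h1
    refine h1.trans ?_
    rw [integral_const_mul, hc fun r => Real.exp (-r) * g r, mul_assoc]
    simp only [mul_assoc]
  have hconst : Real.pi⁻¹ ^ (n + 1) * c = (n.factorial : ℝ)⁻¹ := by
    have := key fun _ => 1
    simp only [mul_one, integral_const, probReal_univ, smul_eq_mul] at this
    rw [integral_pow_mul_exp_neg] at this
    exact eq_inv_of_mul_eq_one_left this.symm
  have hmeas : (cGaussian (Fin (n + 1))).map sqNorm = (volume.restrict (Ioi 0)).withDensity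
      fun r : ℝ => ENNReal.ofReal (r ^ n * Real.exp (-r) / n.factorial) := by
    have : IsProbabilityMeasure ((cGaussian (Fin (n + 1))).map sqNorm) :=
      Measure.isProbabilityMeasure_map measurable_sqNorm.aemeasurable
    ext s hs
    have h1 := key (s.indicator 1)
    have h2 : ∫ z, s.indicator 1 (sqNorm z) ∂(cGaussian (Fin (n + 1))) =
        ((cGaussian (Fin (n + 1))).map sqNorm).real s := by
      rw [← integral_indicator_one hs, integral_map measurable_sqNorm.aemeasurable
        (measurable_one.indicator hs).aestronglyMeasurable]
    rw [← ENNReal.ofReal_toReal (measure_ne_top ((cGaussian (Fin (n + 1))).map sqNorm) s),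
      ← measureReal_def, ← h2, h1, hconst, ← integral_const_mul,
      ofReal_integral_eq_lintegral_ofReal, withDensity_apply _ hs, ← lintegral_indicator hs]
    · refine lintegral_congr fun r => ?_
      by_cases hr : r ∈ s
      · simp [hr, div_eq_inv_mul]
      · simp [hr]
    · refine (Integrable.mul_bdd (c := 1) (integrable_pow_mul_exp_neg n)
        (measurable_one.indicator hs).aestronglyMeasurable (ae_of_all _ fun r => ?_)).const_mul _
      by_cases hr : r ∈ s <;> simp [hr]
    · refine (ae_restrict_iff' measurableSet_Ioi).mpr (ae_of_all _ fun r (hr : 0 < r) => ?_)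
      have : (0 : ℝ) ≤ s.indicator 1 r := indicator_nonneg (by simp) r
      simp only [Pi.zero_apply]
      positivity
  rw [← lintegral_map hf measurable_sqNorm, hmeas, lintegral_withDensity_eq_lintegral_mul _ hw hf]
  exact lintegral_congr fun r => mul_comm _ _

lemma lintegral_sqNorm_pow (n l : ℕ) :
    ∫⁻ z, ENNReal.ofReal (sqNorm z ^ l) ∂(cGaussian (Fin (n + 1))) =
      ENNReal.ofReal ((n + l).factorial / n.factorial) := by
  rw [lintegral_comp_sqNorm n (f := fun r => ENNReal.ofReal (r ^ l)) (by fun_prop),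
    ← integral_pow_mul_exp_neg (n + l), ← integral_div, ofReal_integral_eq_lintegral_ofReal]
  · refine setLIntegral_congr_fun measurableSet_Ioi fun r (hr : 0 < r) => ?_
    rw [← ENNReal.ofReal_mul (by positivity)]
    congr 1
    ring
  · exact (integrable_pow_mul_exp_neg _).div_const _
  · refine (ae_restrict_iff' measurableSet_Ioi).mpr (ae_of_all _ fun r (hr : 0 < r) => ?_)
    simp only [Pi.zero_apply]
    positivity

lemma integrable_sqNorm_pow (n l : ℕ) :
    Integrable (fun z => sqNorm z ^ l) (cGaussian (Fin (n + 1))) := by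
  refine ⟨(measurable_sqNorm.pow_const l).aestronglyMeasurable, ?_⟩
  rw [hasFiniteIntegral_iff_ofReal (ae_of_all _ fun z => pow_nonneg (sqNorm_nonneg z) l),
    lintegral_sqNorm_pow]
  exact ENNReal.ofReal_lt_top

lemma integral_sqNorm_pow (n l : ℕ) :
    ∫ z, sqNorm z ^ l ∂(cGaussian (Fin (n + 1))) = (n + l).factorial / n.factorial := by
  rw [integral_eq_lintegral_of_nonneg_ae (ae_of_all _ fun z => pow_nonneg (sqNorm_nonneg z) l)
    (measurable_sqNorm.pow_const l).aestronglyMeasurable, lintegral_sqNorm_pow,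
    ENNReal.toReal_ofReal (by positivity)]

section Moments

variable {ι : Type*} [Fintype ι] [DecidableEq ι]

/-- A unit linear form of a standard complex Gaussian vector is a standard complex Gaussian
variable. -/
lemma measurePreserving_dotProduct {a : ι → ℂ} (ha : sqNorm a = 1) :
    MeasurePreserving (fun z (_ : Fin 1) => a ⬝ᵥ z) (cGaussian ι) (cGaussian (Fin 1)) := by
  refine measurePreserving_mulVec (Matrix.of fun (_ : Fin 1) i => a i) ?_
  ext i j
  have : a ⬝ᵥ star a = 1 := by rw [dotProduct_comm, star_dotProduct_self, ha, Complex.ofReal_one]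
  rw [Subsingleton.elim i j, Matrix.one_apply_eq]
  exact this

lemma integrable_norm_sq_dotProduct {a : ι → ℂ} (ha : sqNorm a = 1) :
    Integrable (fun z => ‖a ⬝ᵥ z‖ ^ 2) (cGaussian ι) := by
  simpa [sqNorm, Function.comp_def] using
    (measurePreserving_dotProduct ha).integrable_comp_of_integrable (integrable_sqNorm_pow 0 1)

lemma integral_norm_sq_dotProduct {a : ι → ℂ} (ha : sqNorm a = 1) :
    ∫ z, ‖a ⬝ᵥ z‖ ^ 2 ∂(cGaussian ι) = 1 := by
  have h := integral_sqNorm_pow 0 1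
  rw [← (measurePreserving_dotProduct ha).map_eq, integral_map
    (measurePreserving_dotProduct ha).measurable.aemeasurable
    (measurable_sqNorm.pow_const 1).aestronglyMeasurable] at h
  simpa [sqNorm] using h

lemma sqNorm_single (i : ι) : sqNorm (Pi.single i 1 : ι → ℂ) = 1 := by
  rw [sqNorm, Finset.sum_eq_single i (fun j _ hj => by simp [hj]) (by simp)]
  simp

lemma integrable_star_mul (i j : ι) :
    Integrable (fun z : ι → ℂ => star (z i) * z j) (cGaussian ι) := by
  have h : ∀ i, Integrable (fun z : ι → ℂ => ‖z i‖ ^ 2) (cGaussian ι) := fun i => by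
    simpa using integrable_norm_sq_dotProduct (sqNorm_single i)
  refine ((h i).add (h j)).mono' (by fun_prop) (ae_of_all _ fun z => ?_)
  simp only [norm_mul, norm_star, Pi.add_apply]
  nlinarith [sq_nonneg (‖z i‖ - ‖z j‖), norm_nonneg (z i), norm_nonneg (z j)]

/-- The covariance matrix of a standard complex Gaussian vector is the identity. -/
lemma integral_star_mul (i j : ι) :
    ∫ z : ι → ℂ, star (z i) * z j ∂(cGaussian ι) = (1 : Matrix ι ι ℂ) i j := by
  by_cases hij : i = j
  · subst hij
    have h := integral_norm_sq_dotProduct (sqNorm_single i)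
    simp only [single_dotProduct, one_mul] at h
    have h2 : ∀ z : ι → ℂ, star (z i) * z i = ((‖z i‖ ^ 2 : ℝ) : ℂ) := fun z => by
      simp [Complex.conj_mul']
    simp_rw [h2]
    rw [integral_complex_ofReal, h, Matrix.one_apply_eq, Complex.ofReal_one]
  · -- the law is invariant under a change of sign of the `i`-th coordinate
    let d : ι → ℂ := fun k => if k = i then -1 else 1
    have hA : Matrix.diagonal d * (Matrix.diagonal d)ᴴ = 1 := by
      rw [Matrix.diagonal_conjTranspose, Matrix.diagonal_mul_diagonal, ← Matrix.diagonal_one]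
      congr 1
      funext k
      by_cases hk : k = i <;> simp [d, hk]
    have hm := measurePreserving_mulVec _ hA
    have h : ∫ z : ι → ℂ, star (z i) * z j ∂(cGaussian ι) =
        ∫ z : ι → ℂ, -(star (z i) * z j) ∂(cGaussian ι) := by
      conv_lhs => rw [← hm.map_eq]
      rw [integral_map hm.measurable.aemeasurable (by fun_prop)]
      refine integral_congr_ae (ae_of_all _ fun z => ?_)
      simp [Matrix.mulVec_diagonal, d, Ne.symm hij]
    rw [integral_neg] at h
    rw [Matrix.one_apply_ne hij]
    exact self_eq_neg.mp h

lemma integrable_quadratic (B : Matrix ι ι ℂ) :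
    Integrable (fun z => star z ⬝ᵥ (B *ᵥ z)) (cGaussian ι) := by
  simp only [dotProduct, Matrix.mulVec, Finset.mul_sum, Pi.star_apply]
  refine integrable_finsetSum _ fun i _ => integrable_finsetSum _ fun j _ => ?_
  simpa only [mul_left_comm] using (integrable_star_mul i j).const_mul (B i j)

/-- `E zᴴ B z = tr B` for a standard complex Gaussian vector `z`. -/
lemma integral_quadratic (B : Matrix ι ι ℂ) :
    ∫ z, star z ⬝ᵥ (B *ᵥ z) ∂(cGaussian ι) = B.trace := by
  simp only [dotProduct, Matrix.mulVec, Finset.mul_sum, Pi.star_apply, mul_left_comm (star _)]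
  rw [integral_finsetSum _ fun i _ => integrable_finsetSum _ fun j _ =>
    (integrable_star_mul i j).const_mul (B i j)]
  refine Finset.sum_congr rfl fun i _ => ?_
  rw [integral_finsetSum _ fun j _ => (integrable_star_mul i j).const_mul (B i j)]
  simp_rw [integral_const_mul, integral_star_mul]
  simp [Matrix.one_apply]

end Moments

/-! ### The interference matrix -/

/-- Interference-plus-noise matrix `1 + κ ∑ⱼ hⱼ hⱼᴴ` with interfering channel vectors `hⱼ`. -/
def interference {ι : Type*} [DecidableEq ι] {N : ℕ} (κ : ℝ) (h : Fin N → ι → ℂ) :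
    Matrix ι ι ℂ :=
  1 + (κ : ℂ) • ∑ j, Matrix.vecMulVec (h j) (star (h j))

open scoped ComplexOrder in
lemma posDef_interference {ι : Type*} [Fintype ι] [DecidableEq ι] {N : ℕ} {κ : ℝ} (hκ : 0 ≤ κ)
    (h : Fin N → ι → ℂ) : (interference κ h).PosDef := by
  refine Matrix.PosDef.one.add_posSemidef (Matrix.PosSemidef.smul ?_ ?_)
  · exact Matrix.posSemidef_sum _ fun j _ => Matrix.posSemidef_vecMulVec_self_star (h j)
  · exact_mod_cast hκ

lemma det_interference_pos {ι : Type*} [Fintype ι] [DecidableEq ι] {N : ℕ} {κ : ℝ} (hκ : 0 ≤ κ)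
    (h : Fin N → ι → ℂ) : 0 < (interference κ h).det.re :=
  (Complex.pos_iff.mp (posDef_interference hκ h).det_pos).1

lemma isUnit_det_interference {ι : Type*} [Fintype ι] [DecidableEq ι] {N : ℕ} {κ : ℝ}
    (hκ : 0 ≤ κ) (h : Fin N → ι → ℂ) : IsUnit (interference κ h).det :=
  isUnit_iff_ne_zero.mpr fun h0 => (det_interference_pos hκ h).ne' (by simp [h0])

lemma interference_submatrix {ι ι' : Type*} [DecidableEq ι] [DecidableEq ι'] {N : ℕ} (κ : ℝ)
    (h : Fin N → ι → ℂ) {e : ι' → ι} (he : Function.Injective e) :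
    (interference κ h).submatrix e e = interference κ fun j => h j ∘ e := by
  ext i j
  simp [interference, Matrix.one_apply, he.eq_iff, Matrix.sum_apply, Matrix.vecMulVec_apply]

lemma interference_cons {ι : Type*} [DecidableEq ι] {N : ℕ} (κ : ℝ) (v : ι → ℂ)
    (h : Fin N → ι → ℂ) : interference κ (Fin.cons v h : Fin (N + 1) → ι → ℂ) =
      interference κ h + Matrix.vecMulVec v ((κ : ℂ) • star v) := by
  simp only [interference, Fin.sum_univ_succ, Fin.cons_zero, Fin.cons_succ, smul_add,
    Matrix.vecMulVec_smul]
  abel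

lemma continuous_interference {ι : Type*} [DecidableEq ι] {N : ℕ} (κ : ℝ) :
    Continuous (interference κ : (Fin N → ι → ℂ) → Matrix ι ι ℂ) := by
  refine continuous_matrix fun i j => ?_
  simp only [interference, Matrix.add_apply, Matrix.smul_apply, Matrix.sum_apply,
    Matrix.vecMulVec_apply, Pi.star_apply]
  fun_prop

/-- Matrix determinant lemma, with the adjugate. -/
lemma det_add_vecMulVec {ι : Type*} [Fintype ι] [DecidableEq ι] {B : Matrix ι ι ℂ}
    (hB : IsUnit B.det) (u v : ι → ℂ) :
    (B + Matrix.vecMulVec u v).det = B.det + v ⬝ᵥ (B.adjugate *ᵥ u) := by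
  have h : B.det * (v ⬝ᵥ (B⁻¹ *ᵥ u)) = v ⬝ᵥ (B.adjugate *ᵥ u) := by
    rw [Matrix.inv_def, Matrix.smul_mulVec, dotProduct_smul, smul_eq_mul, ← mul_assoc,
      Ring.mul_inverse_cancel _ hB, one_mul]
  rw [Matrix.vecMulVec_eq Unit, Matrix.det_add_replicateCol_mul_replicateRow hB,
    Matrix.mul_assoc, ← Matrix.replicateCol_mulVec, Matrix.det_unique (n := Unit),
    Matrix.add_apply, Matrix.one_apply_eq, Matrix.replicateRow_mul_replicateCol_apply, mul_add,
    mul_one, h]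

/-- A diagonal entry of the adjugate is a principal minor. -/
lemma adjugate_apply_self {n : ℕ} (B : Matrix (Fin (n + 1)) (Fin (n + 1)) ℂ) (i : Fin (n + 1)) :
    B.adjugate i i = (B.submatrix i.succAbove i.succAbove).det := by
  rw [Matrix.adjugate_fin_succ_eq_det_submatrix, ← two_mul, pow_mul]
  simp

/-! ### The expected determinant of the interference matrix -/

/-- The `p`-th Taylor coefficient of `e^x (1 + κ x)^N`. -/
def expMulPowCoeff (κ : ℝ) (N p : ℕ) : ℝ :=
  PowerSeries.coeff p ((1 + PowerSeries.C κ * PowerSeries.X) ^ N * PowerSeries.exp ℝ)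

lemma expMulPowCoeff_zero_left (κ : ℝ) (p : ℕ) : expMulPowCoeff κ 0 p = 1 / p.factorial := by
  simp [expMulPowCoeff, PowerSeries.coeff_exp]

lemma expMulPowCoeff_zero_right (κ : ℝ) (N : ℕ) : expMulPowCoeff κ N 0 = 1 := by
  simp [expMulPowCoeff]

lemma expMulPowCoeff_succ_succ (κ : ℝ) (N p : ℕ) : expMulPowCoeff κ (N + 1) (p + 1) =
    expMulPowCoeff κ N (p + 1) + κ * expMulPowCoeff κ N p := by
  rw [expMulPowCoeff, pow_succ', mul_assoc, add_mul, one_mul, mul_assoc, map_add,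
    PowerSeries.coeff_C_mul, PowerSeries.coeff_succ_X_mul]
  rfl

lemma expMulPowCoeff_nonneg {κ : ℝ} (hκ : 0 ≤ κ) (N p : ℕ) : 0 ≤ expMulPowCoeff κ N p := by
  induction N generalizing p with
  | zero => rw [expMulPowCoeff_zero_left]; positivity
  | succ N ih =>
    cases p with
    | zero => rw [expMulPowCoeff_zero_right]; exact zero_le_one
    | succ p =>
      rw [expMulPowCoeff_succ_succ]
      exact add_nonneg (ih _) (mul_nonneg hκ (ih _))

/-- The law of `N` independent standard complex Gaussian vectors in `ℂ^ι`. -/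
def cGaussianColumns (N : ℕ) (ι : Type*) [Fintype ι] : Measure (Fin N → ι → ℂ) :=
  Measure.pi fun _ => cGaussian ι

instance (N : ℕ) (ι : Type*) [Fintype ι] : IsProbabilityMeasure (cGaussianColumns N ι) := by
  unfold cGaussianColumns; infer_instance

/-- Tonelli's theorem, splitting off the first column. -/
lemma lintegral_cGaussianColumns_succ {N : ℕ} {ι : Type*} [Fintype ι]
    {f : (Fin (N + 1) → ι → ℂ) → ENNReal} (hf : Measurable f) :
    ∫⁻ h, f h ∂(cGaussianColumns (N + 1) ι) =
      ∫⁻ h, ∫⁻ v, f (Fin.cons v h) ∂(cGaussian ι) ∂(cGaussianColumns N ι) := by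
  have e := (measurePreserving_piFinSuccAbove (fun _ : Fin (N + 1) => cGaussian ι) 0).symm
  have h2 : ∀ p : (ι → ℂ) × (Fin N → ι → ℂ),
      (MeasurableEquiv.piFinSuccAbove (fun _ : Fin (N + 1) => ι → ℂ) 0).symm p =
        Fin.cons p.1 p.2 := fun p => by
    simp [MeasurableEquiv.piFinSuccAbove_symm_apply, Fin.insertNthEquiv]
  have hf' : Measurable fun p : (ι → ℂ) × (Fin N → ι → ℂ) =>
      f (Fin.cons p.1 p.2 : Fin (N + 1) → ι → ℂ) := by
    simpa only [← h2, Function.comp_def] using hf.comp (MeasurableEquiv.measurable _)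
  rw [cGaussianColumns, ← e.lintegral_comp_emb (MeasurableEquiv.measurableEmbedding _)]
  simp only [h2]
  exact lintegral_prod_symm' _ hf'

lemma measurePreserving_columns {N : ℕ} {ι ι' : Type*} [Fintype ι] [Fintype ι']
    {g : (ι → ℂ) → ι' → ℂ} (hg : MeasurePreserving g (cGaussian ι) (cGaussian ι')) :
    MeasurePreserving (fun (h : Fin N → ι → ℂ) j => g (h j)) (cGaussianColumns N ι)
      (cGaussianColumns N ι') :=
  measurePreserving_pi _ _ fun _ => hg

/-- A selection of coordinates of a standard complex Gaussian vector is again one. -/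
lemma measurePreserving_comp_injective {ι ι' : Type*} [Fintype ι] [Fintype ι'] [DecidableEq ι]
    [DecidableEq ι'] {e : ι' → ι} (he : Function.Injective e) :
    MeasurePreserving (fun z : ι → ℂ => z ∘ e) (cGaussian ι) (cGaussian ι') := by
  have h := measurePreserving_mulVec
    ((1 : Matrix ι ι ℂ).submatrix e id) (by
      ext i j
      simp [Matrix.mul_apply, Matrix.one_apply, he.eq_iff])
  convert h using 2 with z
  funext i
  simp [Matrix.mulVec, dotProduct, Matrix.one_apply]

/-- The expected determinant of `1 + κ ∑ⱼ hⱼ hⱼᴴ` for `N` standard complex Gaussian vectors in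
`ℂ^n`: exposing one vector at a time, the matrix determinant lemma gives the recursion
`D(N+1, n+1) = D(N, n+1) + κ (n+1) D(N, n)`. -/
theorem lintegral_det_interference {κ : ℝ} (hκ : 0 ≤ κ) (N n : ℕ) :
    ∫⁻ h, ENNReal.ofReal (interference κ h).det.re ∂(cGaussianColumns N (Fin n)) =
      ENNReal.ofReal (n.factorial * expMulPowCoeff κ N n) := by
  have hmeas : ∀ N n : ℕ, Measurable fun h : Fin N → Fin n → ℂ =>
      ENNReal.ofReal (interference κ h).det.re := fun N n => by
    have := (continuous_interference (ι := Fin n) (N := N) κ).matrix_det.measurable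
    exact ENNReal.measurable_ofReal.comp (Complex.measurable_re.comp this)
  induction N generalizing n with
  | zero =>
    rw [expMulPowCoeff_zero_left, mul_one_div_cancel (by positivity)]
    simp [interference]
  | succ N ih =>
    cases n with
    | zero => simp [expMulPowCoeff_zero_right]
    | succ n =>
      have hv : ∀ h : Fin N → Fin (n + 1) → ℂ,
          ∫⁻ v, ENNReal.ofReal (interference κ (Fin.cons v h : Fin (N + 1) → _)).det.re
            ∂(cGaussian (Fin (n + 1))) =
          ENNReal.ofReal (interference κ h).det.re + ∑ i, ENNReal.ofReal κ *
            ENNReal.ofReal (interference κ fun j => h j ∘ Fin.succAbove i).det.re := fun h => by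
        have hre : ∀ v, (interference κ (Fin.cons v h : Fin (N + 1) → _)).det.re =
            ((interference κ h).det +
              (κ : ℂ) * (star v ⬝ᵥ ((interference κ h).adjugate *ᵥ v))).re := fun v => by
          rw [interference_cons, det_add_vecMulVec (isUnit_det_interference hκ h),
            smul_dotProduct, smul_eq_mul]
        have hint : Integrable (fun v => (interference κ h).det +
            (κ : ℂ) * (star v ⬝ᵥ ((interference κ h).adjugate *ᵥ v)))
            (cGaussian (Fin (n + 1))) :=
          (integrable_const _).add ((integrable_quadratic _).const_mul _)
        have hpos : ∀ v, 0 ≤ ((interference κ h).det +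
            (κ : ℂ) * (star v ⬝ᵥ ((interference κ h).adjugate *ᵥ v))).re := fun v => by
          rw [← hre]; exact (det_interference_pos hκ _).le
        simp_rw [hre]
        refine (ofReal_integral_eq_lintegral_ofReal hint.re (ae_of_all _ hpos)).symm.trans ?_
        have : ∫ v, ((interference κ h).det +
            (κ : ℂ) * (star v ⬝ᵥ ((interference κ h).adjugate *ᵥ v))).re
            ∂(cGaussian (Fin (n + 1))) = (interference κ h).det.re +
              ∑ i, κ * (interference κ fun j => h j ∘ Fin.succAbove i).det.re := by
          refine (integral_re hint).trans ?_
          rw [integral_add (integrable_const _) ((integrable_quadratic _).const_mul _),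
            integral_const_mul, integral_quadratic]
          simp [Matrix.trace, adjugate_apply_self, interference_submatrix κ h
            Fin.succAbove_right_injective, Finset.mul_sum]
        refine (congrArg ENNReal.ofReal this).trans ?_
        rw [ENNReal.ofReal_add (det_interference_pos hκ _).le
          (Finset.sum_nonneg fun i _ => mul_nonneg hκ (det_interference_pos hκ _).le),
          ENNReal.ofReal_sum_of_nonneg
            fun i _ => mul_nonneg hκ (det_interference_pos hκ _).le]
        simp_rw [ENNReal.ofReal_mul hκ]
      have hminor : ∀ i : Fin (n + 1), ∫⁻ h : Fin N → Fin (n + 1) → ℂ,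
          ENNReal.ofReal (interference κ fun j => h j ∘ i.succAbove).det.re
            ∂(cGaussianColumns N (Fin (n + 1))) =
          ENNReal.ofReal (n.factorial * expMulPowCoeff κ N n) := fun i => by
        rw [← ih n]
        exact (measurePreserving_columns (measurePreserving_comp_injective
          (Fin.succAbove_right_injective (p := i)))).lintegral_comp (hmeas N n)
      have hm : ∀ i : Fin (n + 1), Measurable fun h : Fin N → Fin (n + 1) → ℂ =>
          ENNReal.ofReal (interference κ fun j => h j ∘ i.succAbove).det.re := fun i =>
        (hmeas N n).comp (measurePreserving_columns (measurePreserving_comp_injective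
          (Fin.succAbove_right_injective (p := i)))).measurable
      rw [lintegral_cGaussianColumns_succ (hmeas _ _)]
      simp_rw [hv]
      rw [lintegral_add_left (hmeas _ _), ih,
        lintegral_finsetSum _ fun i _ => (hm i).const_mul _]
      simp_rw [lintegral_const_mul _ (hm _), hminor]
      have h0 := expMulPowCoeff_nonneg hκ N n
      have h1 := expMulPowCoeff_nonneg hκ N (n + 1)
      rw [Finset.sum_const, Finset.card_univ, Fintype.card_fin, nsmul_eq_mul,
        ← ENNReal.ofReal_mul hκ, ← ENNReal.ofReal_natCast, ← ENNReal.ofReal_mul (by positivity),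
        ← ENNReal.ofReal_add (by positivity) (by positivity), expMulPowCoeff_succ_succ,
        Nat.factorial_succ]
      congr 1
      push_cast
      ring

/-! ### Linear changes of variables -/

/-- A unitary matrix that maps the first coordinate axis onto the line through a given vector. -/
lemma exists_unitary_mulVec_single {n : ℕ} (x : Fin (n + 1) → ℂ) :
    ∃ U : Matrix (Fin (n + 1)) (Fin (n + 1)) ℂ, U * Uᴴ = 1 ∧
      U *ᵥ Pi.single 0 (Real.sqrt (sqNorm x) : ℂ) = x := by
  let E := EuclideanSpace ℂ (Fin (n + 1))
  let y : E := WithLp.toLp 2 x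
  by_cases hx : y = 0
  · have hx' : x = 0 := by
      have : y.ofLp = 0 := by rw [hx]; rfl
      exact this
    exact ⟨1, by simp, by simp [hx', sqNorm]⟩
  have hnorm : Real.sqrt (sqNorm x) = ‖y‖ := by
    rw [sqNorm_eq_norm_toLp, Real.sqrt_sq (norm_nonneg _)]
  have hy : ‖y‖ ≠ 0 := norm_ne_zero_iff.mpr hx
  let v : Fin (n + 1) → E := fun _ => ((‖y‖⁻¹ : ℝ) : ℂ) • y
  have hv : Orthonormal ℂ (({0} : Set (Fin (n + 1))).domRestrict v) := by
    refine ⟨fun i => ?_, fun i j hij => (hij (Subsingleton.elim i j)).elim⟩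
    have : ‖((‖y‖⁻¹ : ℝ) : ℂ) • y‖ = 1 := by
      rw [norm_smul, Complex.norm_real, norm_inv, norm_norm, inv_mul_cancel₀ hy]
    exact this
  obtain ⟨b, hb⟩ := hv.exists_orthonormalBasis_extension_of_card_eq (by simp [E])
  have hb0 : b 0 = ((‖y‖⁻¹ : ℝ) : ℂ) • y := hb 0 rfl
  refine ⟨Matrix.of fun i k => b k i, ?_, ?_⟩
  · rw [mul_eq_one_comm]
    ext k l
    have := orthonormal_iff_ite.mp b.orthonormal k l
    rw [PiLp.inner_apply] at this
    simp only [Matrix.mul_apply, Matrix.conjTranspose_apply, Matrix.of_apply, Matrix.one_apply]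
    rw [← this]
    exact Finset.sum_congr rfl fun i _ => by simp [mul_comm]
  · funext i
    rw [hnorm]
    have h0 : b 0 i = ((‖y‖⁻¹ : ℝ) : ℂ) * x i := by rw [hb0]; rfl
    have hy' : (‖y‖ : ℂ) ≠ 0 := by exact_mod_cast hy
    simp only [Matrix.mulVec_single, Matrix.col_apply, Pi.smul_apply, Matrix.of_apply, h0,
      MulOpposite.smul_eq_mul_unop, MulOpposite.unop_op, Complex.ofReal_inv]
    field_simp

/-- Applying `A` to the interfering vectors keeps the identity in `M` fixed; `B` is the inverse of
`A`, and `B Bᴴ - 1` compensates the change of the noise covariance. -/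
lemma interference_mulVec {ι : Type*} [Fintype ι] [DecidableEq ι] {N : ℕ} (κ : ℝ)
    {A B : Matrix ι ι ℂ} (hAB : A * B = 1) (h : Fin N → ι → ℂ) :
    interference κ (fun j => A *ᵥ h j) =
      A * (interference κ h + (B * Bᴴ - 1)) * Aᴴ := by
  have h1 : interference κ h + (B * Bᴴ - 1) =
      B * Bᴴ + (κ : ℂ) • ∑ j, Matrix.vecMulVec (h j) (star (h j)) := by
    rw [interference]; abel
  have h2 : A * (B * Bᴴ) * Aᴴ = 1 := by
    rw [← Matrix.mul_assoc, hAB, Matrix.one_mul, ← Matrix.conjTranspose_mul, hAB,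
      Matrix.conjTranspose_one]
  rw [h1, mul_add, add_mul, h2, interference, Matrix.mul_smul, Matrix.smul_mul, Finset.mul_sum,
    Finset.sum_mul]
  congr 2
  refine Finset.sum_congr rfl fun j _ => ?_
  rw [Matrix.star_mulVec, ← Matrix.mul_vecMulVec, ← Matrix.vecMulVec_mul, Matrix.mul_assoc]

lemma interference_unitary {ι : Type*} [Fintype ι] [DecidableEq ι] {N : ℕ} (κ : ℝ)
    {U : Matrix ι ι ℂ} (hU : U * Uᴴ = 1) (h : Fin N → ι → ℂ) :
    interference κ (fun j => U *ᵥ h j) = U * interference κ h * Uᴴ := by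
  rw [interference_mulVec κ hU, Matrix.conjTranspose_conjTranspose, mul_eq_one_comm.mp hU, sub_self,
    add_zero]

lemma sqNorm_mulVec {ι : Type*} [Fintype ι] (S : Matrix ι ι ℂ) (z : ι → ℂ) :
    sqNorm (S *ᵥ z) = (star z ⬝ᵥ ((Sᴴ * S) *ᵥ z)).re := by
  rw [← Complex.ofReal_re (sqNorm _), ← star_dotProduct_self, Matrix.star_mulVec,
    ← Matrix.dotProduct_mulVec, Matrix.mulVec_mulVec]

lemma sqNorm_sub_interference {ι : Type*} [Fintype ι] [DecidableEq ι] {N : ℕ} (κ : ℝ)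
    (h : Fin N → ι → ℂ) (u : ι → ℂ) :
    sqNorm u - (star u ⬝ᵥ (interference κ h *ᵥ u)).re = -(κ * ∑ j, ‖star u ⬝ᵥ h j‖ ^ 2) := by
  have h1 : ∀ j, star u ⬝ᵥ (Matrix.vecMulVec (h j) (star (h j)) *ᵥ u) =
      ((‖star u ⬝ᵥ h j‖ ^ 2 : ℝ) : ℂ) := fun j => by
    have : star (h j) ⬝ᵥ u = star (star u ⬝ᵥ h j) := by
      rw [Matrix.star_dotProduct]
    rw [Matrix.vecMulVec_mulVec, this]
    simp only [dotProduct_smul, MulOpposite.smul_eq_mul_unop, MulOpposite.unop_op]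
    rw [← starRingEnd_apply (star u ⬝ᵥ h j), Complex.mul_conj']
    push_cast
    rfl
  rw [interference, Matrix.add_mulVec, Matrix.one_mulVec, Matrix.smul_mulVec, dotProduct_add,
    dotProduct_smul, Matrix.sum_mulVec, dotProduct_sum, star_dotProduct_self]
  simp_rw [h1]
  rw [← Complex.ofReal_sum, smul_eq_mul, ← Complex.ofReal_mul, Complex.add_re,
    Complex.ofReal_re, Complex.ofReal_re]
  ring

open scoped ComplexOrder MatrixOrder in
lemma exists_sqrt_of_posDef {ι : Type*} [Fintype ι] [DecidableEq ι] {M : Matrix ι ι ℂ}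
    (hM : M.PosDef) : ∃ S : Matrix ι ι ℂ, Sᴴ = S ∧ S * S = M :=
  ⟨CFC.sqrt M, (Matrix.nonneg_iff_posSemidef.mp (CFC.sqrt_nonneg M)).isHermitian,
    CFC.sqrt_mul_sqrt_self M hM.posSemidef.nonneg⟩

/-- Substituting `z = M^{1/2} u` moves the random matrix `M` from the quadratic form into the
weight of a Gaussian integral. -/
lemma lintegral_quadratic_inv {n N : ℕ} {κ : ℝ} (hκ : 0 ≤ κ) (h : Fin N → Fin n → ℂ)
    {f : ℝ → ENNReal} (hf : Measurable f) :
    ∫⁻ z, f (star z ⬝ᵥ ((interference κ h)⁻¹ *ᵥ z)).re ∂(cGaussian (Fin n)) =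
      ∫⁻ u, f (sqNorm u) * (ENNReal.ofReal (interference κ h).det.re *
        ENNReal.ofReal (Real.exp (-(κ * ∑ j, ‖star u ⬝ᵥ h j‖ ^ 2)))) ∂(cGaussian (Fin n)) := by
  obtain ⟨S, hS, hSS⟩ := exists_sqrt_of_posDef (posDef_interference hκ h)
  have hSdet : IsUnit S.det := by
    have := isUnit_det_interference hκ h
    rw [← hSS, Matrix.det_mul] at this
    exact isUnit_of_mul_isUnit_left this
  have hinv : S⁻¹ * S = 1 := Matrix.nonsing_inv_mul S hSdet
  have hdet : ‖S.det‖ ^ 2 = (interference κ h).det.re := by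
    have : S.det * star S.det = (interference κ h).det := by
      rw [← Matrix.det_conjTranspose, hS, ← Matrix.det_mul, hSS]
    rw [← this, ← starRingEnd_apply, Complex.mul_conj']
    norm_cast
  have h1 : ∀ z, (star z ⬝ᵥ ((interference κ h)⁻¹ *ᵥ z)).re = sqNorm (S⁻¹ *ᵥ z) := fun z => by
    rw [sqNorm_mulVec, Matrix.conjTranspose_nonsing_inv, hS, ← Matrix.mul_inv_rev, hSS]
  simp_rw [h1]
  rw [lintegral_comp_mulVec S⁻¹ S hinv (f := fun z => f (sqNorm z))
    (hf.comp measurable_sqNorm), hdet, ← lintegral_const_mul']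
  · refine lintegral_congr fun u => ?_
    rw [sqNorm_mulVec, hS, hSS, sqNorm_sub_interference]
    ring
  · exact ENNReal.ofReal_ne_top

/-- Linear change of variables in an integral over independent Gaussian columns; `B` is the
inverse of `A`. -/
lemma lintegral_columns_comp_mulVec {n : ℕ} (A B : Matrix (Fin n) (Fin n) ℂ) (hAB : A * B = 1)
    (N : ℕ) {g : (Fin N → Fin n → ℂ) → ENNReal} (hg : Measurable g) :
    ∫⁻ h, g (fun j => A *ᵥ h j) ∂(cGaussianColumns N (Fin n)) =
      ENNReal.ofReal (‖B.det‖ ^ 2) ^ N * ∫⁻ h, g h *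
        ∏ j, ENNReal.ofReal (Real.exp (sqNorm (h j) - sqNorm (B *ᵥ h j)))
          ∂(cGaussianColumns N (Fin n)) := by
  induction N with
  | zero =>
    simp only [pow_zero, one_mul, Finset.univ_eq_empty, Finset.prod_empty, mul_one]
    exact lintegral_congr fun h => congrArg g (Subsingleton.elim _ _)
  | succ N ih =>
    let w : (Fin n → ℂ) → ENNReal := fun v =>
      ENNReal.ofReal (Real.exp (sqNorm v - sqNorm (B *ᵥ v)))
    have hw : Measurable w := by
      have h1 := measurable_sqNorm (ι := Fin n)
      have h2 : Measurable fun z : Fin n → ℂ => B *ᵥ z := by fun_prop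
      have := h1.comp h2
      fun_prop
    have hcons : Measurable fun p : (Fin N → Fin n → ℂ) × (Fin n → ℂ) =>
        (Fin.cons p.2 p.1 : Fin (N + 1) → Fin n → ℂ) := by
      refine measurable_pi_lambda _ fun j => ?_
      refine Fin.cases ?_ (fun j => ?_) j
      · exact measurable_snd
      · exact (measurable_pi_apply j).comp measurable_fst
    have hA : Measurable fun v : Fin n → ℂ => A *ᵥ v := by fun_prop
    have hAN : ∀ N, Measurable fun (h : Fin N → Fin n → ℂ) j => A *ᵥ h j := fun N =>
      measurable_pi_lambda _ fun j => hA.comp (measurable_pi_apply j)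
    have hprod : Measurable fun h : Fin (N + 1) → Fin n → ℂ => ∏ j, w (h j) :=
      Finset.measurable_prod _ fun j _ => hw.comp (measurable_pi_apply j)
    have hG : Measurable fun h : Fin N → Fin n → ℂ =>
        ∫⁻ v, g (Fin.cons v h : Fin (N + 1) → _) * w v ∂(cGaussian (Fin n)) :=
      Measurable.lintegral_prod_right' (f := fun p : (Fin N → Fin n → ℂ) × (Fin n → ℂ) =>
        g (Fin.cons p.2 p.1 : Fin (N + 1) → _) * w p.2)
        ((hg.comp hcons).mul (hw.comp measurable_snd))
    have hcomp : ∀ v (h : Fin N → Fin n → ℂ),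
        (fun j => A *ᵥ (Fin.cons v h : Fin (N + 1) → _) j) =
          (Fin.cons (A *ᵥ v) (fun j => A *ᵥ h j) : Fin (N + 1) → _) := fun v h => by
      funext j
      refine Fin.cases rfl (fun j => rfl) j
    rw [lintegral_cGaussianColumns_succ (f := fun h => g fun j => A *ᵥ h j) (hg.comp (hAN _)),
      lintegral_cGaussianColumns_succ (f := fun h => g h * ∏ j, w (h j)) (hg.mul hprod)]
    simp only [Fin.prod_univ_succ, Fin.cons_zero, Fin.cons_succ, hcomp]
    have h1 : ∀ h : Fin N → Fin n → ℂ,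
        ∫⁻ v, g (Fin.cons (A *ᵥ v) (fun j => A *ᵥ h j) : Fin (N + 1) → _) ∂(cGaussian (Fin n)) =
          ENNReal.ofReal (‖B.det‖ ^ 2) * ∫⁻ v, g (Fin.cons v (fun j => A *ᵥ h j) :
            Fin (N + 1) → _) * w v ∂(cGaussian (Fin n)) := fun h =>
      lintegral_comp_mulVec A B hAB (f := fun v => g (Fin.cons v (fun j => A *ᵥ h j) :
            Fin (N + 1) → _))
        (hg.comp (hcons.comp (measurable_const.prodMk measurable_id)))
    simp_rw [h1]
    have hGA := hG.comp (hAN N)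
    simp only [Function.comp_def] at hGA
    rw [lintegral_const_mul _ hGA, ih hG, pow_succ' (ENNReal.ofReal _), mul_assoc]
    congr 2
    refine lintegral_congr fun h => ?_
    rw [← lintegral_mul_const]
    · refine lintegral_congr fun v => ?_
      rw [mul_assoc]
    · exact (hg.comp (hcons.comp (measurable_const.prodMk measurable_id))).mul hw

/-! ### The law of the quadratic form `zᴴ M⁻¹ z` -/

lemma continuous_inv_interference {ι : Type*} [Fintype ι] [DecidableEq ι] {N : ℕ} {κ : ℝ}
    (hκ : 0 ≤ κ) : Continuous fun h : Fin N → ι → ℂ => (interference κ h)⁻¹ := by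
  have hc := continuous_interference (ι := ι) (N := N) κ
  simp only [Matrix.inv_def, Ring.inverse_eq_inv']
  exact (hc.matrix_det.inv₀ fun h => (isUnit_det_interference hκ h).ne_zero).smul
    hc.matrix_adjugate

lemma continuous_quadratic_inv {ι : Type*} [Fintype ι] [DecidableEq ι] {N : ℕ} {κ : ℝ}
    (hκ : 0 ≤ κ) : Continuous fun p : (ι → ℂ) × (Fin N → ι → ℂ) =>
      (star p.1 ⬝ᵥ ((interference κ p.2)⁻¹ *ᵥ p.1)).re := by
  have := (continuous_inv_interference (ι := ι) (N := N) hκ).comp continuous_snd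
    (X := (ι → ℂ) × (Fin N → ι → ℂ))
  exact Complex.continuous_re.comp
    (continuous_fst.star.dotProduct (this.matrix_mulVec continuous_fst))

/-- By unitary invariance the law of `xᴴ M⁻¹ x`, for a fixed vector `x` and the random
interference matrix `M`, depends on the norm of `x` only. -/
theorem lintegral_quadratic_inv_eq {n N : ℕ} {κ : ℝ} (hκ : 0 ≤ κ) (x : Fin (n + 1) → ℂ)
    {f : ℝ → ENNReal} (hf : Measurable f) :
    ∫⁻ h, f (star x ⬝ᵥ ((interference κ h)⁻¹ *ᵥ x)).re ∂(cGaussianColumns N (Fin (n + 1))) =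
      ∫⁻ h, f (sqNorm x * ((interference κ h)⁻¹ 0 0).re)
        ∂(cGaussianColumns N (Fin (n + 1))) := by
  obtain ⟨U, hU, hx⟩ := exists_unitary_mulVec_single x
  have hU' : Uᴴ * U = 1 := mul_eq_one_comm.mp hU
  have hm : Measurable fun h : Fin N → Fin (n + 1) → ℂ =>
      f (star x ⬝ᵥ ((interference κ h)⁻¹ *ᵥ x)).re :=
    hf.comp ((continuous_quadratic_inv hκ).comp (Continuous.prodMk_right x)).measurable
  rw [← (measurePreserving_columns (measurePreserving_mulVec U hU)).lintegral_comp hm]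
  refine lintegral_congr fun h => congrArg f ?_
  have hinv : (interference κ fun j => U *ᵥ h j)⁻¹ = U * (interference κ h)⁻¹ * Uᴴ := by
    rw [interference_unitary κ hU, Matrix.mul_inv_rev, Matrix.mul_inv_rev,
      Matrix.inv_eq_right_inv hU, Matrix.inv_eq_right_inv hU', Matrix.mul_assoc]
  have hUx : Uᴴ *ᵥ x = Pi.single 0 (Real.sqrt (sqNorm x) : ℂ) := by
    conv_lhs => rw [← hx]
    rw [Matrix.mulVec_mulVec, hU', Matrix.one_mulVec]
  have hxU : star x ᵥ* U = star (Pi.single 0 (Real.sqrt (sqNorm x) : ℂ) : Fin (n + 1) → ℂ) := by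
    rw [← hUx, Matrix.star_mulVec, Matrix.conjTranspose_conjTranspose]
  rw [hinv, ← Matrix.mulVec_mulVec, ← Matrix.mulVec_mulVec, hUx, Matrix.dotProduct_mulVec, hxU]
  have hs : star (Pi.single 0 (Real.sqrt (sqNorm x) : ℂ) : Fin (n + 1) → ℂ) =
      Pi.single 0 (Real.sqrt (sqNorm x) : ℂ) := by
    rw [← Pi.single_star]
    simp
  have hr : ((Real.sqrt (sqNorm x) : ℝ) : ℂ) * (Real.sqrt (sqNorm x) : ℝ) = (sqNorm x : ℂ) := by
    rw [← Complex.ofReal_mul, Real.mul_self_sqrt (sqNorm_nonneg x)]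
  rw [hs, single_dotProduct, Matrix.mulVec_single]
  simp only [Matrix.col_apply, Pi.smul_apply, MulOpposite.smul_eq_mul_unop, MulOpposite.unop_op]
  rw [mul_comm _ ((Real.sqrt (sqNorm x) : ℝ) : ℂ), ← mul_assoc, hr, Complex.re_ofReal_mul]

/-- The Gaussian weight, rotated to the first coordinate and absorbed by rescaling it, turns
`E det M` into a combination of two expected determinants. -/
theorem lintegral_det_mul_exp {n N : ℕ} {κ : ℝ} (hκ : 0 ≤ κ) (u : Fin (n + 1) → ℂ) :
    ∫⁻ h, ENNReal.ofReal (interference κ h).det.re *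
        ENNReal.ofReal (Real.exp (-(κ * ∑ j, ‖star u ⬝ᵥ h j‖ ^ 2)))
          ∂(cGaussianColumns N (Fin (n + 1))) =
      ENNReal.ofReal (((n + 1).factorial * expMulPowCoeff κ N (n + 1) +
        κ * sqNorm u * (n.factorial * expMulPowCoeff κ N n)) /
          (1 + κ * sqNorm u) ^ (N + 1)) := by
  set r := sqNorm u with hr
  have hr0 : 0 ≤ r := sqNorm_nonneg u
  have hd : 0 < 1 + κ * r := by positivity
  have hdet : ∀ n : ℕ, Measurable fun h : Fin N → Fin n → ℂ =>
      ENNReal.ofReal (interference κ h).det.re := fun n =>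
    ENNReal.measurable_ofReal.comp (Complex.measurable_re.comp
      (continuous_interference κ).matrix_det.measurable)
  obtain ⟨U, hU, hx⟩ := exists_unitary_mulVec_single u
  have hU' : Uᴴ * U = 1 := mul_eq_one_comm.mp hU
  have hm : Measurable fun h : Fin N → Fin (n + 1) → ℂ =>
      ENNReal.ofReal (interference κ h).det.re *
        ENNReal.ofReal (Real.exp (-(κ * ∑ j, ‖star u ⬝ᵥ h j‖ ^ 2))) := by
    refine (hdet _).mul ?_
    have : ∀ j, Measurable fun h : Fin N → Fin (n + 1) → ℂ => star u ⬝ᵥ h j := fun j => by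
      simp only [dotProduct]
      fun_prop
    fun_prop
  rw [← (measurePreserving_columns (measurePreserving_mulVec U hU)).lintegral_comp hm]
  have hrot : ∀ h : Fin N → Fin (n + 1) → ℂ,
      ENNReal.ofReal (interference κ fun j => U *ᵥ h j).det.re *
        ENNReal.ofReal (Real.exp (-(κ * ∑ j, ‖star u ⬝ᵥ (U *ᵥ h j)‖ ^ 2))) =
      ENNReal.ofReal (interference κ h).det.re *
        ENNReal.ofReal (Real.exp (-(κ * ∑ j, r * ‖h j 0‖ ^ 2))) := fun h => by
    have h1 : (interference κ fun j => U *ᵥ h j).det = (interference κ h).det := by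
      rw [interference_unitary κ hU, Matrix.det_mul, Matrix.det_mul, mul_right_comm,
        ← Matrix.det_mul, hU, Matrix.det_one, one_mul]
    have h2 : star u ᵥ* U = Pi.single 0 (Real.sqrt r : ℂ) := by
      have : Uᴴ *ᵥ u = Pi.single 0 (Real.sqrt r : ℂ) := by
        conv_lhs => rw [← hx]
        rw [Matrix.mulVec_mulVec, hU', Matrix.one_mulVec]
      calc star u ᵥ* U = star (Uᴴ *ᵥ u) := by
            rw [Matrix.star_mulVec, Matrix.conjTranspose_conjTranspose]
        _ = _ := by rw [this, ← Pi.single_star]; simp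
    have h3 : ∀ j, ‖star u ⬝ᵥ (U *ᵥ h j)‖ ^ 2 = r * ‖h j 0‖ ^ 2 := fun j => by
      rw [Matrix.dotProduct_mulVec, h2, single_dotProduct, norm_mul, mul_pow, Complex.norm_real,
        Real.norm_of_nonneg (Real.sqrt_nonneg r), Real.sq_sqrt hr0]
    simp_rw [h1, h3]
  simp_rw [hrot]
  -- The weight is `∏ⱼ exp (-κ r |hⱼ(0)|²)`; dividing the first coordinate of each `hⱼ` by
  -- `√(1 + κ r)` absorbs it into the Gaussian density.
  let b : Fin (n + 1) → ℂ := fun i => if i = 0 then (Real.sqrt (1 + κ * r) : ℂ) else 1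
  let B : Matrix (Fin (n + 1)) (Fin (n + 1)) ℂ := Matrix.diagonal b
  have hs : ((Real.sqrt (1 + κ * r) : ℝ) : ℂ) * (Real.sqrt (1 + κ * r) : ℝ) =
      ((1 + κ * r : ℝ) : ℂ) := by
    rw [← Complex.ofReal_mul, Real.mul_self_sqrt hd.le]
  have hBdet : B.det = (Real.sqrt (1 + κ * r) : ℂ) := by
    simp [B, b, Matrix.det_diagonal]
  have hBnorm : ‖B.det‖ ^ 2 = 1 + κ * r := by
    rw [hBdet, Complex.norm_real, Real.norm_of_nonneg (Real.sqrt_nonneg _), Real.sq_sqrt hd.le]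
  have hBunit : IsUnit B.det := by
    rw [hBdet, isUnit_iff_ne_zero]
    exact_mod_cast (Real.sqrt_pos.mpr hd).ne'
  have hBB : B * Bᴴ - 1 = Matrix.vecMulVec (Pi.single 0 1) (Pi.single 0 ((κ * r : ℝ) : ℂ)) := by
    ext i j
    rw [Matrix.diagonal_conjTranspose, Matrix.diagonal_mul_diagonal, Matrix.sub_apply,
      Matrix.vecMulVec_apply]
    by_cases hij : i = j
    · subst hij
      by_cases hi : i = 0
      · subst hi
        simp only [Matrix.diagonal_apply_eq, Matrix.one_apply_eq, Pi.single_eq_same, b, if_true,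
          Pi.star_apply, one_mul]
        rw [← starRingEnd_apply, Complex.conj_ofReal, hs]
        push_cast
        ring
      · simp [b, hi]
    · rw [Matrix.diagonal_apply_ne _ hij, Matrix.one_apply_ne hij]
      by_cases hi : i = 0
      · subst hi
        simp [Ne.symm hij]
      · simp [hi]
  have hB1 := lintegral_columns_comp_mulVec B⁻¹ B (Matrix.nonsing_inv_mul B hBunit) N
    (hdet (n + 1))
  have hweight : ∀ h : Fin N → Fin (n + 1) → ℂ,
      ∏ j, ENNReal.ofReal (Real.exp (sqNorm (h j) - sqNorm (B *ᵥ h j))) =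
        ENNReal.ofReal (Real.exp (-(κ * ∑ j, r * ‖h j 0‖ ^ 2))) := fun h => by
    rw [← ENNReal.ofReal_prod_of_nonneg fun _ _ => by positivity, ← Real.exp_sum, Finset.mul_sum,
      ← Finset.sum_neg_distrib]
    congr 2
    refine Finset.sum_congr rfl fun j _ => ?_
    simp only [sqNorm, B, Matrix.mulVec_diagonal, Fin.sum_univ_succ, b, Fin.succ_ne_zero, if_true,
      if_false, norm_one, one_pow, one_mul, norm_mul, mul_pow, Complex.norm_real,
      Real.norm_of_nonneg (Real.sqrt_nonneg _), Real.sq_sqrt hd.le]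
    ring
  simp_rw [hweight, hBnorm] at hB1
  have hresc : ∀ h : Fin N → Fin (n + 1) → ℂ,
      ENNReal.ofReal (interference κ fun j => B⁻¹ *ᵥ h j).det.re =
        ENNReal.ofReal (1 + κ * r)⁻¹ * (ENNReal.ofReal (interference κ h).det.re +
          ENNReal.ofReal (κ * r) *
            ENNReal.ofReal (interference κ fun j => h j ∘ Fin.succAbove 0).det.re) := fun h => by
    have hBinv : B⁻¹.det * B⁻¹ᴴ.det = (((1 + κ * r)⁻¹ : ℝ) : ℂ) := by
      rw [Matrix.det_conjTranspose, Matrix.det_nonsing_inv, Ring.inverse_eq_inv', star_inv₀, hBdet,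
        ← starRingEnd_apply, Complex.conj_ofReal, ← mul_inv, hs, Complex.ofReal_inv]
    rw [interference_mulVec κ (Matrix.nonsing_inv_mul B hBunit), hBB, Matrix.det_mul,
      Matrix.det_mul, mul_right_comm, hBinv, det_add_vecMulVec (isUnit_det_interference hκ h),
      single_dotProduct, Matrix.mulVec_single_one, Matrix.col_apply, adjugate_apply_self,
      interference_submatrix κ h Fin.succAbove_right_injective, Complex.re_ofReal_mul,
      Complex.add_re, Complex.re_ofReal_mul, ENNReal.ofReal_mul (by positivity),
      ENNReal.ofReal_add (det_interference_pos hκ _).le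
        (mul_nonneg (by positivity) (det_interference_pos hκ _).le),
      ENNReal.ofReal_mul (by positivity)]
  have hmp := measurePreserving_columns (N := N) (measurePreserving_comp_injective
    (Fin.succAbove_right_injective (p := (0 : Fin (n + 1)))))
  have hminor := (hmp.lintegral_comp (hdet n)).trans (lintegral_det_interference hκ N n)
  have h0 := expMulPowCoeff_nonneg hκ N n
  have h1 := expMulPowCoeff_nonneg hκ N (n + 1)
  have hmm := (hdet n).comp hmp.measurable
  simp only [Function.comp_def] at hmm hminor
  simp_rw [hresc] at hB1
  simp only [Function.comp_def] at hB1
  have hsum := (hdet (n + 1)).add (hmm.const_mul (ENNReal.ofReal (κ * r)))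
  simp only [Pi.add_def] at hsum
  rw [lintegral_const_mul _ hsum,
    lintegral_add_left (hdet (n + 1)), lintegral_const_mul _ hmm, hminor,
    lintegral_det_interference hκ, ← ENNReal.ofReal_mul (by positivity),
    ← ENNReal.ofReal_add (by positivity) (by positivity), ← ENNReal.ofReal_mul (by positivity),
    ← ENNReal.ofReal_pow hd.le] at hB1
  rw [← ENNReal.mul_right_inj (a := ENNReal.ofReal ((1 + κ * r) ^ N))
    (by simpa using pow_pos hd N) ENNReal.ofReal_ne_top, ← hB1,
    ← ENNReal.ofReal_mul (by positivity)]
  congr 1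
  field_simp
  ring

/-- The law of `zᴴ M⁻¹ z` for a standard complex Gaussian vector `z` independent of the
interference matrix `M`, through its density. -/
theorem lintegral_lintegral_quadratic_inv {n N : ℕ} {κ : ℝ} (hκ : 0 ≤ κ) {f : ℝ → ENNReal}
    (hf : Measurable f) :
    ∫⁻ h, ∫⁻ z, f (star z ⬝ᵥ ((interference κ h)⁻¹ *ᵥ z)).re ∂(cGaussian (Fin (n + 1)))
        ∂(cGaussianColumns N (Fin (n + 1))) =
      ∫⁻ r in Ioi 0, f r * ENNReal.ofReal (Real.exp (-r) / (1 + κ * r) ^ (N + 1) *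
        ((n + 1) * expMulPowCoeff κ N (n + 1) * r ^ n +
          κ * expMulPowCoeff κ N n * r ^ (n + 1))) := by
  have hΨ : Measurable fun r : ℝ => ENNReal.ofReal (((n + 1).factorial *
      expMulPowCoeff κ N (n + 1) + κ * r * (n.factorial * expMulPowCoeff κ N n)) /
        (1 + κ * r) ^ (N + 1)) := by fun_prop
  have hc : Continuous fun p : (Fin N → Fin (n + 1) → ℂ) × (Fin (n + 1) → ℂ) =>
      Real.exp (-(κ * ∑ j, ‖star p.2 ⬝ᵥ p.1 j‖ ^ 2)) := by
    simp only [dotProduct, Pi.star_apply]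
    fun_prop
  have hdet : Measurable fun h : Fin N → Fin (n + 1) → ℂ =>
      ENNReal.ofReal (interference κ h).det.re :=
    ENNReal.measurable_ofReal.comp (Complex.measurable_re.comp
      (continuous_interference κ).matrix_det.measurable)
  simp_rw [lintegral_quadratic_inv hκ _ hf]
  rw [lintegral_lintegral_swap]
  · have h1 : ∀ u : Fin (n + 1) → ℂ, ∫⁻ h, f (sqNorm u) *
        (ENNReal.ofReal (interference κ h).det.re *
          ENNReal.ofReal (Real.exp (-(κ * ∑ j, ‖star u ⬝ᵥ h j‖ ^ 2))))
            ∂(cGaussianColumns N (Fin (n + 1))) = f (sqNorm u) *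
        ENNReal.ofReal (((n + 1).factorial * expMulPowCoeff κ N (n + 1) +
          κ * sqNorm u * (n.factorial * expMulPowCoeff κ N n)) /
            (1 + κ * sqNorm u) ^ (N + 1)) := fun u => by
      rw [lintegral_const_mul, lintegral_det_mul_exp hκ]
      exact hdet.mul (ENNReal.measurable_ofReal.comp
        (hc.comp (Continuous.prodMk_left u)).measurable)
    simp_rw [h1]
    rw [lintegral_comp_sqNorm n (f := fun r => f r * ENNReal.ofReal (((n + 1).factorial *
      expMulPowCoeff κ N (n + 1) + κ * r * (n.factorial * expMulPowCoeff κ N n)) /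
        (1 + κ * r) ^ (N + 1))) (hf.mul hΨ)]
    refine setLIntegral_congr_fun measurableSet_Ioi fun r (hr : 0 < r) => ?_
    have h0 := expMulPowCoeff_nonneg hκ N n
    have h1 := expMulPowCoeff_nonneg hκ N (n + 1)
    rw [mul_assoc, ← ENNReal.ofReal_mul (by positivity)]
    congr 2
    rw [Nat.factorial_succ]
    push_cast
    have : (n.factorial : ℝ) ≠ 0 := by positivity
    have : 1 + κ * r ≠ 0 := by positivity
    field_simp
    ring
  · exact ((hf.comp (measurable_sqNorm.comp measurable_snd)).mul
      ((hdet.comp measurable_fst).mul (ENNReal.measurable_ofReal.comp hc.measurable))).aemeasurable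

/-! ### The tail of the quadratic form and `ϑ_l` -/

lemma expMulPowCoeff_one (κ : ℝ) (N : ℕ) : expMulPowCoeff κ N 1 = 1 + N * κ := by
  induction N with
  | zero => simp [expMulPowCoeff_zero_left]
  | succ N ih => rw [expMulPowCoeff_succ_succ, ih, expMulPowCoeff_zero_right]; push_cast; ring

/-- Differential equation `(1 + κ x) g' = (1 + κ x + N κ) g` of `g = e^x (1 + κ x)^N`, on
coefficients. -/
lemma expMulPowCoeff_recurrence (κ : ℝ) (N p : ℕ) :
    (p + 2) * expMulPowCoeff κ N (p + 2) + κ * (p + 1) * expMulPowCoeff κ N (p + 1) =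
      (1 + N * κ) * expMulPowCoeff κ N (p + 1) + κ * expMulPowCoeff κ N p := by
  induction N generalizing p with
  | zero =>
    simp only [expMulPowCoeff_zero_left]
    rw [Nat.factorial_succ (p + 1), Nat.factorial_succ p]
    push_cast
    have : (p.factorial : ℝ) ≠ 0 := by positivity
    field_simp
    ring
  | succ N ih =>
    have h1 := ih p
    cases p with
    | zero =>
      simp only [expMulPowCoeff_succ_succ, expMulPowCoeff_zero_right] at h1 ⊢
      rw [expMulPowCoeff_one] at h1 ⊢
      push_cast at h1 ⊢
      linear_combination h1
    | succ p =>
      have h2 := ih p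
      simp only [expMulPowCoeff_succ_succ] at h1 ⊢
      push_cast at h1 h2 ⊢
      linear_combination h1 + κ * h2

/-- The binomial theorem, on coefficients. -/
lemma coeff_one_add_C_mul_X_pow (κ : ℝ) (N i : ℕ) :
    PowerSeries.coeff i ((1 + PowerSeries.C κ * PowerSeries.X) ^ N) = N.choose i * κ ^ i := by
  have h : (1 + PowerSeries.C κ * PowerSeries.X) ^ N =
      PowerSeries.rescale κ (((1 + Polynomial.X) ^ N : Polynomial ℝ) : PowerSeries ℝ) := by
    rw [Polynomial.coe_pow, map_pow, Polynomial.coe_add, Polynomial.coe_one, Polynomial.coe_X,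
      map_add, map_one, PowerSeries.rescale_X]
  rw [h, PowerSeries.coeff_rescale, Polynomial.coeff_coe, Polynomial.coeff_one_add_X_pow, mul_comm]

/-- `ρ_p` is the `p`-th Taylor coefficient of `e^x (1 + κ x)^(Nj - 1)`: it is their Cauchy
product, restricted to the indices with a nonzero binomial coefficient. -/
lemma rho_eq_expMulPowCoeff {Na Nj Ne : ℕ} (C : WiretapChannel Na Nj Ne) (hκ : C.kappa ≠ 0)
    (p : ℕ) : C.rho p = expMulPowCoeff C.kappa (Nj - 1) p := by
  rw [expMulPowCoeff, PowerSeries.coeff_mul, WiretapChannel.rho, Finset.mul_sum,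
    ← Finset.Nat.sum_antidiagonal_swap, Finset.Nat.sum_antidiagonal_eq_sum_range_succ_mk]
  have hsub : Finset.Icc (p - (Nj - 1)) p ⊆ Finset.range (p + 1) := fun q hq => by
    rw [Finset.mem_Icc] at hq
    rw [Finset.mem_range]
    omega
  refine Finset.sum_subset_zero_on_sdiff hsub (fun q hq => ?_) fun q hq => ?_
  · rw [Finset.mem_sdiff, Finset.mem_range, Finset.mem_Icc] at hq
    simp only [Prod.fst_swap, Prod.snd_swap, coeff_one_add_C_mul_X_pow]
    rw [Nat.choose_eq_zero_of_lt (by omega)]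
    simp
  · rw [Finset.mem_Icc] at hq
    simp only [Prod.fst_swap, Prod.snd_swap, coeff_one_add_C_mul_X_pow, PowerSeries.coeff_exp]
    have : C.kappa ^ p = C.kappa ^ (p - q) * C.kappa ^ q := by
      rw [← pow_add, Nat.sub_add_cancel hq.2]
    rw [this]
    have : (q.factorial : ℝ) ≠ 0 := by positivity
    simp
    field_simp

/-- The tail `e^{-r} (1 + κ r)^{-N} ∑_{p < n} ρ_p r^p` of the law of `zᴴ M⁻¹ z`. -/
def quadraticTail (κ : ℝ) (N n : ℕ) (r : ℝ) : ℝ :=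
  Real.exp (-r) / (1 + κ * r) ^ N * ∑ p ∈ Finset.range n, expMulPowCoeff κ N p * r ^ p

/-- The derivative of the tail is minus the density found in `lintegral_lintegral_quadratic_inv`:
all but the two top terms cancel by `expMulPowCoeff_recurrence`. -/
lemma hasDerivAt_quadraticTail {κ : ℝ} (hκ : 0 ≤ κ) (N n : ℕ) {r : ℝ} (hr : 0 ≤ r) :
    HasDerivAt (quadraticTail κ N (n + 1))
      (-(Real.exp (-r) / (1 + κ * r) ^ (N + 1) * ((n + 1) * expMulPowCoeff κ N (n + 1) * r ^ n +
          κ * expMulPowCoeff κ N n * r ^ (n + 1)))) r := by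
  have hpos : 1 + κ * r ≠ 0 := by positivity
  have hbase : HasDerivAt (fun r => Real.exp (-r) / (1 + κ * r) ^ N)
      (-(Real.exp (-r) / (1 + κ * r) ^ (N + 1) * (1 + κ * r + N * κ))) r := by
    have h1 : HasDerivAt (fun r => Real.exp (-r)) (-Real.exp (-r)) r := by
      simpa using (hasDerivAt_neg r).exp
    have h2 : HasDerivAt (fun r => (1 + κ * r) ^ N) (N * (1 + κ * r) ^ (N - 1) * κ) r := by
      have : HasDerivAt (fun r => 1 + κ * r) κ r := by
        simpa using ((hasDerivAt_id r).const_mul κ).const_add 1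
      exact this.pow N
    refine (h1.div h2 (pow_ne_zero _ hpos)).congr_deriv ?_
    cases N with
    | zero => simp; field_simp
    | succ N =>
      simp only [Nat.add_sub_cancel]
      field_simp
      push_cast
      ring
  induction n with
  | zero =>
    have : quadraticTail κ N (0 + 1) = fun r => Real.exp (-r) / (1 + κ * r) ^ N := by
      funext r
      simp [quadraticTail, expMulPowCoeff_zero_right]
    rw [this]
    refine hbase.congr_deriv ?_
    simp only [zero_add, expMulPowCoeff_zero_right, expMulPowCoeff_one, Nat.cast_zero, pow_zero,
      pow_one, mul_one, one_mul]
    ring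
  | succ n ih =>
    have hsplit : quadraticTail κ N (n + 1 + 1) = fun r => quadraticTail κ N (n + 1) r +
        Real.exp (-r) / (1 + κ * r) ^ N * (expMulPowCoeff κ N (n + 1) * r ^ (n + 1)) := by
      funext r
      rw [quadraticTail, Finset.sum_range_succ, mul_add]
      rfl
    rw [hsplit]
    have hpow : HasDerivAt (fun r => expMulPowCoeff κ N (n + 1) * r ^ (n + 1))
        (expMulPowCoeff κ N (n + 1) * ((n + 1) * r ^ n)) r := by
      have := (hasDerivAt_pow (n + 1) r).const_mul (expMulPowCoeff κ N (n + 1))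
      simpa using this
    refine (ih.add (hbase.mul hpow)).congr_deriv ?_
    have hrec := expMulPowCoeff_recurrence κ N n
    have he : Real.exp (-r) / (1 + κ * r) ^ N =
        Real.exp (-r) / (1 + κ * r) ^ (N + 1) * (1 + κ * r) := by
      field_simp
      ring
    rw [he]
    push_cast
    linear_combination (Real.exp (-r) / (1 + κ * r) ^ (N + 1) * r ^ (n + 1)) * hrec

lemma integrable_pow_mul_exp_div {κ : ℝ} (hκ : 0 ≤ κ) (m N : ℕ) :
    IntegrableOn (fun r : ℝ => r ^ m * (Real.exp (-r) / (1 + κ * r) ^ N)) (Ioi 0) := by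
  refine (integrable_pow_mul_exp_neg m).mono' (by fun_prop) ?_
  refine (ae_restrict_iff' measurableSet_Ioi).mpr (ae_of_all _ fun r (hr : 0 < r) => ?_)
  have h1 : (1 : ℝ) ≤ (1 + κ * r) ^ N := one_le_pow₀ (by nlinarith)
  rw [Real.norm_of_nonneg (by positivity)]
  exact mul_le_mul_of_nonneg_left (div_le_self (Real.exp_pos _).le h1) (by positivity)

/-- The substitution `s = r + 1/κ` and the binomial theorem express the moments of the tail by
upper incomplete gamma functions. -/
lemma integral_pow_mul_exp_div {κ : ℝ} (hκ : 0 < κ) (m N : ℕ) :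
    ∫ r in Ioi (0 : ℝ), r ^ m * (Real.exp (-r) / (1 + κ * r) ^ N) =
      Real.exp (1 / κ) / κ ^ N * ∑ t ∈ Finset.range (m + 1), (m.choose t : ℝ) *
        (-(1 / κ)) ^ (m - t) * upperIncGamma ((t : ℝ) - N + 1) (1 / κ) := by
  set c := 1 / κ with hc
  have hc0 : 0 < c := by positivity
  have h1 := (measurePreserving_add_right volume c).setIntegral_preimage_emb
    (measurableEmbedding_addRight c)
    (fun s : ℝ => (s - c) ^ m * (Real.exp (-(s - c)) / (κ * s) ^ N)) (Ioi c)
  have hpre : (fun x : ℝ => x + c) ⁻¹' Ioi c = Ioi 0 := by ext x; simp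
  rw [hpre] at h1
  have h2 : ∀ r : ℝ, κ * (r + c) = 1 + κ * r := fun r => by
    rw [hc]; field_simp; ring
  simp only [add_sub_cancel_right, h2] at h1
  rw [h1]
  have hint : ∀ t : ℕ, IntegrableOn
      (fun s : ℝ => Real.exp (-s) * s ^ ((t : ℝ) - N + 1 - 1)) (Ioi c) := fun t => by
    have hsub : Ioi c ⊆ Ioi 0 := Ioi_subset_Ioi hc0.le
    refine (((integrable_pow_mul_exp_neg t).mono_set hsub).const_mul (c ^ N)⁻¹).mono'
      (by fun_prop) ?_
    refine (ae_restrict_iff' measurableSet_Ioi).mpr (ae_of_all _ fun s (hs : c < s) => ?_)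
    have hs0 : 0 < s := hc0.trans hs
    rw [add_sub_cancel_right, Real.rpow_sub hs0, Real.rpow_natCast, Real.rpow_natCast,
      Real.norm_of_nonneg (by positivity), mul_comm (Real.exp _), div_mul_eq_mul_div,
      div_eq_inv_mul]
    gcongr
  have h3 : ∀ s ∈ Ioi c, (s - c) ^ m * (Real.exp (-(s - c)) / (κ * s) ^ N) =
      ∑ t ∈ Finset.range (m + 1), (Real.exp c / κ ^ N * ((m.choose t : ℝ) * (-c) ^ (m - t))) *
        (Real.exp (-s) * s ^ ((t : ℝ) - N + 1 - 1)) := fun s hs => by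
    have hs0 : 0 < s := hc0.trans hs
    have : Real.exp (-(s - c)) = Real.exp c * Real.exp (-s) := by
      rw [← Real.exp_add]; ring_nf
    rw [sub_eq_add_neg, add_pow, Finset.sum_mul, ← sub_eq_add_neg, this]
    refine Finset.sum_congr rfl fun t _ => ?_
    rw [add_sub_cancel_right, Real.rpow_sub hs0, Real.rpow_natCast, Real.rpow_natCast, mul_pow]
    field_simp
  rw [setIntegral_congr_fun measurableSet_Ioi h3, integral_finsetSum _ fun t _ =>
    (hint t).const_mul _, Finset.mul_sum]
  refine Finset.sum_congr rfl fun t _ => ?_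
  rw [integral_const_mul, upperIncGamma, mul_assoc]

lemma kappa_pos {Na Nj Ne : ℕ} (hNj : 2 ≤ Nj) (C : WiretapChannel Na Nj Ne) : 0 < C.kappa := by
  have h1 := C.Pj_pos
  have h2 := Real.rpow_pos_of_pos C.dje_pos (-C.ηje)
  have h3 := C.σe_pos
  have h4 : (2 : ℝ) ≤ Nj := by exact_mod_cast hNj
  have h5 : 0 < (Nj : ℝ) - 1 := by linarith
  unfold WiretapChannel.kappa WiretapChannel.snrJE
  positivity

/-- `ϑ_l` is the integral of `l r^{l-1}` times the tail of the law of `zᴴ M⁻¹ z`. -/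
lemma vartheta_eq_integral {Na Nj Ne : ℕ} (hNj : 2 ≤ Nj) (C : WiretapChannel Na Nj Ne) (l : ℕ) :
    C.vartheta (l + 1) =
      ∫ r in Ioi (0 : ℝ), (l + 1) * r ^ l * quadraticTail C.kappa (Nj - 1) Ne r := by
  have hκ := kappa_pos hNj C
  have hsplit : ∀ r : ℝ, (l + 1) * r ^ l * quadraticTail C.kappa (Nj - 1) Ne r =
      ∑ p ∈ Finset.range Ne, ((l + 1) * expMulPowCoeff C.kappa (Nj - 1) p) *
        (r ^ (l + p) * (Real.exp (-r) / (1 + C.kappa * r) ^ (Nj - 1))) := fun r => by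
    rw [quadraticTail, Finset.mul_sum, Finset.mul_sum]
    refine Finset.sum_congr rfl fun p _ => ?_
    rw [pow_add]
    ring
  simp_rw [hsplit]
  rw [integral_finsetSum _ fun p _ => (integrable_pow_mul_exp_div hκ.le _ _).const_mul _,
    WiretapChannel.vartheta, Finset.mul_sum]
  refine Finset.sum_congr rfl fun p _ => ?_
  rw [integral_const_mul, integral_pow_mul_exp_div hκ, rho_eq_expMulPowCoeff C hκ.ne']
  have hN : ∀ t : ℕ, (t : ℝ) - Nj + 2 = (t : ℝ) - (Nj - 1 : ℕ) + 1 := fun t => by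
    rw [Nat.cast_sub (by omega)]
    push_cast
    ring
  simp only [hN, Nat.add_sub_cancel]
  push_cast
  ring

/-- `ϑ_l` is the `l`-th moment of the law of `zᴴ M⁻¹ z`: integration by parts. -/
lemma lintegral_pow_eq_vartheta {Na Nj n : ℕ} (hNj : 2 ≤ Nj)
    (C : WiretapChannel Na Nj (n + 1)) (l : ℕ) :
    ∫⁻ r in Ioi 0, ENNReal.ofReal (r ^ (l + 1)) *
      ENNReal.ofReal (Real.exp (-r) / (1 + C.kappa * r) ^ (Nj - 1 + 1) *
        ((n + 1) * expMulPowCoeff C.kappa (Nj - 1) (n + 1) * r ^ n +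
          C.kappa * expMulPowCoeff C.kappa (Nj - 1) n * r ^ (n + 1))) =
      ENNReal.ofReal (C.vartheta (l + 1)) := by
  have hκ := kappa_pos hNj C
  set κ := C.kappa
  set N := Nj - 1
  set d : ℝ → ℝ := fun r => Real.exp (-r) / (1 + κ * r) ^ (N + 1) *
        ((n + 1) * expMulPowCoeff κ N (n + 1) * r ^ n + κ * expMulPowCoeff κ N n * r ^ (n + 1))
    with hd
  have hdint : IntegrableOn (fun r => r ^ (l + 1) * d r) (Ioi 0) := by
    have h1 := ((integrable_pow_mul_exp_div hκ.le (l + 1 + n) (N + 1)).const_mul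
      ((n + 1) * expMulPowCoeff κ N (n + 1))).add
      ((integrable_pow_mul_exp_div hκ.le (l + 1 + (n + 1)) (N + 1)).const_mul
        (κ * expMulPowCoeff κ N n))
    refine IntegrableOn.congr_fun h1 (fun r _ => ?_) measurableSet_Ioi
    simp only [hd, Pi.add_apply]
    ring
  have hTint : IntegrableOn (fun r => (l + 1) * r ^ l * quadraticTail κ N (n + 1) r) (Ioi 0) := by
    have h1 : IntegrableOn (fun r => ∑ p ∈ Finset.range (n + 1), ((l + 1) * expMulPowCoeff κ N p) *
        (r ^ (l + p) * (Real.exp (-r) / (1 + κ * r) ^ N))) (Ioi 0) :=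
      integrable_finsetSum _ fun p _ => (integrable_pow_mul_exp_div hκ.le _ _).const_mul _
    refine h1.congr_fun (fun r _ => ?_) measurableSet_Ioi
    simp only [quadraticTail, Finset.mul_sum]
    refine Finset.sum_congr rfl fun p _ => ?_
    rw [pow_add]
    ring
  have hderiv : ∀ r ∈ Ici (0 : ℝ), HasDerivAt (fun r => r ^ (l + 1) * quadraticTail κ N (n + 1) r)
      ((l + 1) * r ^ l * quadraticTail κ N (n + 1) r - r ^ (l + 1) * d r) r := fun r hr => by
    refine ((hasDerivAt_pow (l + 1) r).mul (hasDerivAt_quadraticTail hκ.le N n hr)).congr_deriv ?_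
    simp only [hd, Nat.add_sub_cancel]
    push_cast
    ring
  have hlim : Filter.Tendsto (fun r => r ^ (l + 1) * quadraticTail κ N (n + 1) r) Filter.atTop
      (nhds 0) := by
    have h1 : Filter.Tendsto (fun r : ℝ => ∑ p ∈ Finset.range (n + 1), expMulPowCoeff κ N p *
        (r ^ (l + 1 + p) * Real.exp (-r))) Filter.atTop (nhds 0) := by
      rw [show (0 : ℝ) = ∑ p ∈ Finset.range (n + 1), expMulPowCoeff κ N p * 0 by simp]
      exact tendsto_finsetSum _ fun p _ =>
        (Real.tendsto_pow_mul_exp_neg_atTop_nhds_zero _).const_mul _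
    refine squeeze_zero' ?_ ?_ h1
    · filter_upwards [Filter.eventually_ge_atTop (0 : ℝ)] with r hr
      have h1 : 0 ≤ ∑ p ∈ Finset.range (n + 1), expMulPowCoeff κ N p * r ^ p :=
        Finset.sum_nonneg fun p _ => mul_nonneg (expMulPowCoeff_nonneg hκ.le N p) (by positivity)
      unfold quadraticTail
      positivity
    · filter_upwards [Filter.eventually_ge_atTop (0 : ℝ)] with r hr
      rw [quadraticTail, Finset.mul_sum, Finset.mul_sum]
      refine Finset.sum_le_sum fun p _ => ?_
      have h1 : (1 : ℝ) ≤ (1 + κ * r) ^ N := one_le_pow₀ (by nlinarith)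
      have h2 := div_le_self (Real.exp_pos (-r)).le h1
      have h3 : 0 ≤ expMulPowCoeff κ N p * r ^ (l + 1 + p) :=
        mul_nonneg (expMulPowCoeff_nonneg hκ.le N p) (by positivity)
      calc r ^ (l + 1) * (Real.exp (-r) / (1 + κ * r) ^ N * (expMulPowCoeff κ N p * r ^ p))
          = expMulPowCoeff κ N p * r ^ (l + 1 + p) * (Real.exp (-r) / (1 + κ * r) ^ N) := by ring
        _ ≤ expMulPowCoeff κ N p * r ^ (l + 1 + p) * Real.exp (-r) :=
          mul_le_mul_of_nonneg_left h2 h3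
        _ = _ := by ring
  have hzero := integral_Ioi_of_hasDerivAt_of_tendsto' hderiv (hTint.sub hdint) hlim
  rw [integral_sub hTint hdint] at hzero
  have hmain : C.vartheta (l + 1) = ∫ r in Ioi (0 : ℝ), r ^ (l + 1) * d r := by
    rw [vartheta_eq_integral hNj]
    simp at hzero
    linarith
  have hdnonneg : ∀ r ∈ Ioi (0 : ℝ), 0 ≤ d r := fun r (hr : 0 < r) => by
    have h0 := expMulPowCoeff_nonneg hκ.le N n
    have h1 := expMulPowCoeff_nonneg hκ.le N (n + 1)
    simp only [hd]
    positivity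
  rw [hmain, ofReal_integral_eq_lintegral_ofReal hdint]
  · refine setLIntegral_congr_fun measurableSet_Ioi fun r (hr : 0 < r) => ?_
    exact (ENNReal.ofReal_mul (by positivity)).symm
  · refine (ae_restrict_iff' measurableSet_Ioi).mpr (ae_of_all _ fun r (hr : 0 < r) => ?_)
    exact mul_nonneg (by positivity) (hdnonneg r hr)

/-! ### Moments of the quadratic form with a general signal -/

/-- The quadratic form `xᴴ M⁻¹ x` of a signal vector `x` and the interference matrix `M` of the
vectors `h`. -/
def sinrForm {ι : Type*} [Fintype ι] [DecidableEq ι] {N : ℕ} (κ : ℝ)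
    (p : (ι → ℂ) × (Fin N → ι → ℂ)) : ℝ :=
  (star p.1 ⬝ᵥ ((interference κ p.2)⁻¹ *ᵥ p.1)).re

open scoped ComplexOrder in
lemma sinrForm_nonneg {ι : Type*} [Fintype ι] [DecidableEq ι] {N : ℕ} {κ : ℝ} (hκ : 0 ≤ κ)
    (p : (ι → ℂ) × (Fin N → ι → ℂ)) : 0 ≤ sinrForm κ p :=
  (posDef_interference hκ p.2).inv.posSemidef.re_dotProduct_nonneg p.1

lemma measurable_sinrForm {ι : Type*} [Fintype ι] [DecidableEq ι] {N : ℕ} {κ : ℝ} (hκ : 0 ≤ κ) :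
    Measurable (sinrForm κ : (ι → ℂ) × (Fin N → ι → ℂ) → ℝ) :=
  (continuous_quadratic_inv hκ).measurable

open scoped ComplexOrder in
lemma inv_interference_apply_pos {ι : Type*} [Fintype ι] [DecidableEq ι] {N : ℕ} {κ : ℝ}
    (hκ : 0 ≤ κ) (h : Fin N → ι → ℂ) (i : ι) : 0 < ((interference κ h)⁻¹ i i).re :=
  (Complex.pos_iff.mp ((posDef_interference hκ h).inv.diag_pos (i := i))).1

lemma measurable_inv_interference_apply {ι : Type*} [Fintype ι] [DecidableEq ι] {N : ℕ} {κ : ℝ}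
    (hκ : 0 ≤ κ) (i : ι) : Measurable fun h : Fin N → ι → ℂ => ((interference κ h)⁻¹ i i).re :=
  (Complex.continuous_re.comp ((continuous_inv_interference hκ).matrix_elem i i)).measurable

/-- The moments of `xᴴ M⁻¹ x` factor when `x` is independent of `M`. -/
lemma lintegral_sinrForm_pow {n N : ℕ} {κ : ℝ} (hκ : 0 ≤ κ) (ν : Measure (Fin (n + 1) → ℂ))
    [SFinite ν] (l : ℕ) :
    ∫⁻ p, ENNReal.ofReal (sinrForm κ p ^ l) ∂(ν.prod (cGaussianColumns N (Fin (n + 1)))) =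
      (∫⁻ x, ENNReal.ofReal (sqNorm x ^ l) ∂ν) *
        ∫⁻ h, ENNReal.ofReal (((interference κ h)⁻¹ 0 0).re ^ l)
          ∂(cGaussianColumns N (Fin (n + 1))) := by
  have hV := (measurable_inv_interference_apply (N := N) hκ (0 : Fin (n + 1))).pow_const l
  rw [lintegral_prod _ ((measurable_sinrForm hκ).pow_const l).ennreal_ofReal.aemeasurable]
  have h1 : ∀ x : Fin (n + 1) → ℂ, ∫⁻ h, ENNReal.ofReal (sinrForm κ (x, h) ^ l)
      ∂(cGaussianColumns N (Fin (n + 1))) = ENNReal.ofReal (sqNorm x ^ l) *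
        ∫⁻ h, ENNReal.ofReal (((interference κ h)⁻¹ 0 0).re ^ l)
          ∂(cGaussianColumns N (Fin (n + 1))) := fun x => by
    have h2 := lintegral_quadratic_inv_eq (N := N) hκ x
      (f := fun r => ENNReal.ofReal (r ^ l)) (by fun_prop)
    refine h2.trans ?_
    simp_rw [mul_pow, ENNReal.ofReal_mul (pow_nonneg (sqNorm_nonneg x) l)]
    exact lintegral_const_mul _ hV.ennreal_ofReal
  simp_rw [h1]
  exact lintegral_mul_const _ (measurable_sqNorm.pow_const l).ennreal_ofReal

/-- The `l`-th moment of a diagonal entry of the inverse of the interference matrix. -/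
def invMoment (κ : ℝ) (N n l : ℕ) : ℝ :=
  ∫ h, ((interference κ h)⁻¹ 0 0).re ^ l ∂(cGaussianColumns N (Fin (n + 1)))

section InvMoment

variable {Na Nj n : ℕ}

lemma vartheta_nonneg (hNj : 2 ≤ Nj) (C : WiretapChannel Na Nj (n + 1))
    (l : ℕ) : 0 ≤ C.vartheta (l + 1) := by
  have hκ := kappa_pos hNj C
  rw [vartheta_eq_integral hNj]
  refine setIntegral_nonneg measurableSet_Ioi fun r (hr : 0 < r) => ?_
  have h1 : 0 ≤ ∑ p ∈ Finset.range (n + 1), expMulPowCoeff C.kappa (Nj - 1) p * r ^ p :=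
    Finset.sum_nonneg fun p _ => mul_nonneg (expMulPowCoeff_nonneg hκ.le _ p) (by positivity)
  unfold quadraticTail
  positivity

lemma lintegral_inv_interference_pow (hNj : 2 ≤ Nj) (C : WiretapChannel Na Nj (n + 1))
    (l : ℕ) :
    ∫⁻ h, ENNReal.ofReal (((interference C.kappa h)⁻¹ 0 0).re ^ (l + 1))
      ∂(cGaussianColumns (Nj - 1) (Fin (n + 1))) =
      ENNReal.ofReal (C.vartheta (l + 1) / ((n + (l + 1)).factorial / n.factorial)) := by
  have hκ := kappa_pos hNj C
  have h1 := lintegral_sinrForm_pow (N := Nj - 1) hκ.le (cGaussian (Fin (n + 1))) (l + 1)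
  rw [lintegral_sqNorm_pow, lintegral_prod_symm'
    _ ((measurable_sinrForm hκ.le).pow_const _).ennreal_ofReal] at h1
  have h2 := lintegral_lintegral_quadratic_inv (n := n) (N := Nj - 1) hκ.le
    (f := fun r => ENNReal.ofReal (r ^ (l + 1))) (by fun_prop)
  rw [lintegral_pow_eq_vartheta hNj] at h2
  have h3 := h1.symm.trans h2
  have hc : (0 : ℝ) < (n + (l + 1)).factorial / n.factorial := by positivity
  rw [← ENNReal.mul_right_inj (a := ENNReal.ofReal ((n + (l + 1)).factorial / n.factorial))
    (by simpa using hc) ENNReal.ofReal_ne_top, h3, ← ENNReal.ofReal_mul hc.le,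
    mul_div_cancel₀ _ hc.ne']

lemma integrable_inv_interference_pow (hNj : 2 ≤ Nj) (C : WiretapChannel Na Nj (n + 1))
    (l : ℕ) :
    Integrable (fun h => ((interference C.kappa h)⁻¹ 0 0).re ^ (l + 1))
      (cGaussianColumns (Nj - 1) (Fin (n + 1))) := by
  have hκ := kappa_pos hNj C
  refine ⟨((measurable_inv_interference_apply hκ.le 0).pow_const _).aestronglyMeasurable, ?_⟩
  rw [hasFiniteIntegral_iff_ofReal (ae_of_all _ fun h =>
    pow_nonneg (inv_interference_apply_pos hκ.le h 0).le _), lintegral_inv_interference_pow hNj]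
  exact ENNReal.ofReal_lt_top

lemma invMoment_eq (hNj : 2 ≤ Nj) (C : WiretapChannel Na Nj (n + 1)) (l : ℕ) :
    invMoment C.kappa (Nj - 1) n (l + 1) =
    C.vartheta (l + 1) / ((n + (l + 1)).factorial / n.factorial) := by
  have hκ := kappa_pos hNj C
  rw [invMoment, integral_eq_lintegral_of_nonneg_ae (ae_of_all _ fun h =>
    pow_nonneg (inv_interference_apply_pos hκ.le h 0).le _)
    (integrable_inv_interference_pow hNj C l).aestronglyMeasurable,
    lintegral_inv_interference_pow hNj,
    ENNReal.toReal_ofReal (div_nonneg (vartheta_nonneg hNj C l) (by positivity))]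

lemma invMoment_one_pos (hNj : 2 ≤ Nj) (C : WiretapChannel Na Nj (n + 1)) :
    0 < invMoment C.kappa (Nj - 1) n 1 := by
  have hκ := kappa_pos hNj C
  have hpos := fun h : Fin (Nj - 1) → Fin (n + 1) → ℂ => inv_interference_apply_pos hκ.le h 0
  simp only [invMoment, pow_one]
  rw [integral_pos_iff_support_of_nonneg (fun h => (hpos h).le)
    (by simpa using integrable_inv_interference_pow hNj C 0)]
  rw [Function.support_eq_univ fun h => (hpos h).ne']
  simp

lemma sq_invMoment_one_le (hNj : 2 ≤ Nj) (C : WiretapChannel Na Nj (n + 1)) :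
    invMoment C.kappa (Nj - 1) n 1 ^ 2 ≤ invMoment C.kappa (Nj - 1) n 2 := by
  have hκ := kappa_pos hNj C
  have hm : MemLp (fun h : Fin (Nj - 1) → Fin (n + 1) → ℂ =>
      ((interference C.kappa h)⁻¹ 0 0).re) 2 (cGaussianColumns (Nj - 1) (Fin (n + 1))) :=
    (memLp_two_iff_integrable_sq
      (measurable_inv_interference_apply hκ.le 0).aestronglyMeasurable).mpr
      (integrable_inv_interference_pow hNj C 1)
  have := variance_nonneg (fun h : Fin (Nj - 1) → Fin (n + 1) → ℂ =>
      ((interference C.kappa h)⁻¹ 0 0).re) (cGaussianColumns (Nj - 1) (Fin (n + 1)))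
  rw [variance_eq_sub hm] at this
  simp only [invMoment, pow_one]
  simpa using this

/-- Moments of `xᴴ M⁻¹ x` for a random vector `x` independent of `M`. -/
lemma integrable_sinrForm_pow (hNj : 2 ≤ Nj) (C : WiretapChannel Na Nj (n + 1))
    {ν : Measure (Fin (n + 1) → ℂ)} [SFinite ν] (l : ℕ)
    (hν : Integrable (fun x => sqNorm x ^ (l + 1)) ν) :
    Integrable (fun p => sinrForm C.kappa p ^ (l + 1))
      (ν.prod (cGaussianColumns (Nj - 1) (Fin (n + 1)))) := by
  have hκ := kappa_pos hNj C
  refine ⟨((measurable_sinrForm hκ.le).pow_const _).aestronglyMeasurable, ?_⟩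
  rw [hasFiniteIntegral_iff_ofReal (ae_of_all _ fun p => pow_nonneg (sinrForm_nonneg hκ.le p) _),
    lintegral_sinrForm_pow hκ.le, lintegral_inv_interference_pow hNj]
  refine ENNReal.mul_lt_top ?_ ENNReal.ofReal_lt_top
  rw [← hasFiniteIntegral_iff_ofReal (ae_of_all _ fun x => pow_nonneg (sqNorm_nonneg x) _)]
  exact hν.hasFiniteIntegral

lemma integral_sinrForm_pow (hNj : 2 ≤ Nj) (C : WiretapChannel Na Nj (n + 1))
    {ν : Measure (Fin (n + 1) → ℂ)} [SFinite ν] (l : ℕ)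
    (hν : Integrable (fun x => sqNorm x ^ (l + 1)) ν) :
    ∫ p, sinrForm C.kappa p ^ (l + 1) ∂(ν.prod (cGaussianColumns (Nj - 1) (Fin (n + 1)))) =
      (∫ x, sqNorm x ^ (l + 1) ∂ν) * invMoment C.kappa (Nj - 1) n (l + 1) := by
  have hκ := kappa_pos hNj C
  rw [integral_eq_lintegral_of_nonneg_ae (ae_of_all _ fun p =>
      pow_nonneg (sinrForm_nonneg hκ.le p) _)
      ((measurable_sinrForm hκ.le).pow_const _).aestronglyMeasurable,
    lintegral_sinrForm_pow hκ.le, ENNReal.toReal_mul,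
    integral_eq_lintegral_of_nonneg_ae (ae_of_all _ fun x => pow_nonneg (sqNorm_nonneg x) _)
      hν.aestronglyMeasurable, invMoment,
    integral_eq_lintegral_of_nonneg_ae (ae_of_all _ fun h =>
      pow_nonneg (inv_interference_apply_pos hκ.le h 0).le _)
      (integrable_inv_interference_pow hNj C l).aestronglyMeasurable]

end InvMoment

/-! ### Moments of the squared norm of a noncentral complex Gaussian vector -/

section Noncentral

variable {n : ℕ} (a : Fin (n + 1) → ℂ)

lemma sqNorm_add_smul {ι : Type*} [Fintype ι] (a z : ι → ℂ) (s : ℝ) :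
    sqNorm (a + (s : ℂ) • z) = sqNorm a + 2 * s * (star a ⬝ᵥ z).re + s ^ 2 * sqNorm z := by
  simp only [sqNorm, dotProduct, Complex.re_sum, Finset.mul_sum, ← Finset.sum_add_distrib]
  refine Finset.sum_congr rfl fun i _ => ?_
  simp only [← Complex.normSq_eq_norm_sq, Complex.normSq_apply, Pi.add_apply, Pi.smul_apply,
    Pi.star_apply, smul_eq_mul, Complex.add_re, Complex.add_im, Complex.mul_re, Complex.mul_im,
    Complex.ofReal_re, Complex.ofReal_im, Complex.star_def, Complex.conj_re, Complex.conj_im]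
  ring

lemma measurePreserving_smul {ι : Type*} [Fintype ι] [DecidableEq ι] {c : ℂ} (hc : ‖c‖ = 1) :
    MeasurePreserving (fun z => c • z) (cGaussian ι) (cGaussian ι) := by
  have h := measurePreserving_mulVec (c • (1 : Matrix ι ι ℂ)) (by
    rw [Matrix.conjTranspose_smul, Matrix.conjTranspose_one, Matrix.smul_mul, Matrix.mul_smul,
      Matrix.one_mul, smul_smul, ← starRingEnd_apply, Complex.mul_conj', hc]
    simp)
  simpa [Matrix.smul_mulVec] using h

lemma norm_sq_dotProduct_eq (z : Fin (n + 1) → ℂ) :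
    ((‖star a ⬝ᵥ z‖ ^ 2 : ℝ) : ℂ) = star z ⬝ᵥ (Matrix.vecMulVec a (star a) *ᵥ z) := by
  rw [Matrix.vecMulVec_mulVec, dotProduct_smul, MulOpposite.smul_eq_mul_unop,
    MulOpposite.unop_op, Matrix.star_dotProduct z a, mul_comm,
    ← starRingEnd_apply (star a ⬝ᵥ z), Complex.mul_conj']
  push_cast
  rfl

lemma integrable_norm_sq_star_dotProduct :
    Integrable (fun z => ‖star a ⬝ᵥ z‖ ^ 2) (cGaussian (Fin (n + 1))) := by
  have h := (integrable_quadratic (Matrix.vecMulVec a (star a))).re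
  simp_rw [← norm_sq_dotProduct_eq] at h
  exact h

lemma integral_norm_sq_star_dotProduct :
    ∫ z, ‖star a ⬝ᵥ z‖ ^ 2 ∂(cGaussian (Fin (n + 1))) = sqNorm a := by
  have h := integral_quadratic (Matrix.vecMulVec a (star a))
  simp_rw [← norm_sq_dotProduct_eq] at h
  rw [integral_complex_ofReal, Matrix.trace_vecMulVec, dotProduct_comm, star_dotProduct_self] at h
  exact_mod_cast h

lemma sq_re_le_norm_sq (z : ℂ) : z.re ^ 2 ≤ ‖z‖ ^ 2 := by
  rw [← Complex.normSq_eq_norm_sq, Complex.normSq_apply]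
  nlinarith [mul_self_nonneg z.im]

lemma measurable_re_star_dotProduct :
    Measurable fun z : Fin (n + 1) → ℂ => (star a ⬝ᵥ z).re := by
  have : Continuous fun z : Fin (n + 1) → ℂ => star a ⬝ᵥ z :=
    continuous_const.dotProduct continuous_id
  exact (Complex.continuous_re.comp this).measurable

lemma integrable_re_sq :
    Integrable (fun z => (star a ⬝ᵥ z).re ^ 2) (cGaussian (Fin (n + 1))) := by
  refine (integrable_norm_sq_star_dotProduct a).mono'
    ((measurable_re_star_dotProduct a).pow_const 2).aestronglyMeasurable
    (ae_of_all _ fun z => ?_)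
  rw [Real.norm_of_nonneg (sq_nonneg _)]
  exact sq_re_le_norm_sq _

lemma integrable_re :
    Integrable (fun z => (star a ⬝ᵥ z).re) (cGaussian (Fin (n + 1))) := by
  refine ((integrable_const 1).add (integrable_re_sq a)).mono'
    (measurable_re_star_dotProduct a).aestronglyMeasurable (ae_of_all _ fun z => ?_)
  simp only [Pi.add_apply, Real.norm_eq_abs]
  nlinarith [sq_abs (star a ⬝ᵥ z).re, sq_nonneg (|(star a ⬝ᵥ z).re| - 1)]

lemma integrable_re_mul_sqNorm :
    Integrable (fun z => (star a ⬝ᵥ z).re * sqNorm z) (cGaussian (Fin (n + 1))) := by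
  have hm := measurable_sqNorm (ι := Fin (n + 1))
  refine ((integrable_sqNorm_pow n 2).add (integrable_re_sq a)).mono'
    ((measurable_re_star_dotProduct a).mul hm).aestronglyMeasurable (ae_of_all _ fun z => ?_)
  simp only [Pi.add_apply, Real.norm_eq_abs, abs_mul, abs_of_nonneg (sqNorm_nonneg z)]
  nlinarith [sq_abs (star a ⬝ᵥ z).re, sq_nonneg (|(star a ⬝ᵥ z).re| - sqNorm z),
    sq_nonneg (|(star a ⬝ᵥ z).re| + sqNorm z)]

/-- Odd functions have mean zero under the complex Gaussian law. -/
lemma integral_eq_zero_of_odd {f : (Fin (n + 1) → ℂ) → ℝ}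
    (hf : AEStronglyMeasurable f (cGaussian (Fin (n + 1)))) (hodd : ∀ z, f (-z) = -f z) :
    ∫ z, f z ∂(cGaussian (Fin (n + 1))) = 0 := by
  have hmp := measurePreserving_smul (ι := Fin (n + 1)) (c := -1) (by simp)
  have h : ∫ z, f z ∂(cGaussian (Fin (n + 1))) = ∫ z, f ((-1 : ℂ) • z) ∂(cGaussian _) := by
    conv_lhs => rw [← hmp.map_eq]
    exact integral_map hmp.measurable.aemeasurable (by rwa [hmp.map_eq])
  simp only [neg_smul, one_smul, hodd, integral_neg] at h
  linarith

lemma integral_re_sq :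
    ∫ z, (star a ⬝ᵥ z).re ^ 2 ∂(cGaussian (Fin (n + 1))) = sqNorm a / 2 := by
  -- multiplication by `i` exchanges the real and imaginary parts
  have hmp := measurePreserving_smul (ι := Fin (n + 1)) (c := Complex.I) (by simp)
  have hI : ∫ z, (star a ⬝ᵥ z).re ^ 2 ∂(cGaussian (Fin (n + 1))) =
      ∫ z, (star a ⬝ᵥ z).im ^ 2 ∂(cGaussian (Fin (n + 1))) := by
    conv_lhs => rw [← hmp.map_eq]
    rw [integral_map hmp.measurable.aemeasurable
      (by rw [hmp.map_eq]; exact (integrable_re_sq a).aestronglyMeasurable)]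
    refine integral_congr_ae (ae_of_all _ fun z => ?_)
    simp [dotProduct_smul]
  have hsplit : ∀ z : Fin (n + 1) → ℂ,
      (star a ⬝ᵥ z).im ^ 2 = ‖star a ⬝ᵥ z‖ ^ 2 - (star a ⬝ᵥ z).re ^ 2 := fun z => by
    rw [← Complex.normSq_eq_norm_sq, Complex.normSq_apply]
    ring
  simp_rw [hsplit] at hI
  rw [integral_sub (integrable_norm_sq_star_dotProduct a) (integrable_re_sq a),
    integral_norm_sq_star_dotProduct] at hI
  linarith

lemma integral_re_eq_zero : ∫ z, (star a ⬝ᵥ z).re ∂(cGaussian (Fin (n + 1))) = 0 :=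
  integral_eq_zero_of_odd (integrable_re a).aestronglyMeasurable fun z => by
    rw [dotProduct_neg, Complex.neg_re]

lemma integral_re_mul_sqNorm :
    ∫ z, (star a ⬝ᵥ z).re * sqNorm z ∂(cGaussian (Fin (n + 1))) = 0 :=
  integral_eq_zero_of_odd (integrable_re_mul_sqNorm a).aestronglyMeasurable fun z => by
    rw [dotProduct_neg, Complex.neg_re, neg_mul]
    simp [sqNorm]

variable (s : ℝ)

lemma integrable_sqNorm_noncentral :
    Integrable (fun z => sqNorm (a + (s : ℂ) • z) ^ 1) (cGaussian (Fin (n + 1))) := by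
  simp only [pow_one, sqNorm_add_smul]
  have h := integrable_sqNorm_pow n 1
  simp only [pow_one] at h
  exact ((integrable_const _).add ((integrable_re a).const_mul _)).add (h.const_mul _)

lemma integral_sqNorm_noncentral :
    ∫ z, sqNorm (a + (s : ℂ) • z) ^ 1 ∂(cGaussian (Fin (n + 1))) =
      sqNorm a + s ^ 2 * (n + 1) := by
  have h := integrable_sqNorm_pow n 1
  have h' := integral_sqNorm_pow n 1
  simp only [pow_one] at h h'
  simp only [pow_one, sqNorm_add_smul]
  refine (integral_add ((integrable_const _).add ((integrable_re a).const_mul _))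
    (h.const_mul _)).trans ?_
  rw [integral_add' (integrable_const _) ((integrable_re a).const_mul _), integral_const_mul,
    integral_const_mul, integral_re_eq_zero, h', Nat.factorial_succ]
  have : (n.factorial : ℝ) ≠ 0 := by positivity
  simp only [integral_const, probReal_univ, one_smul]
  push_cast
  field_simp
  ring

lemma sq_sqNorm_add_smul (z : Fin (n + 1) → ℂ) : sqNorm (a + (s : ℂ) • z) ^ 2 =
    (((sqNorm a ^ 2 + 4 * sqNorm a * s * (star a ⬝ᵥ z).re) +
      2 * sqNorm a * s ^ 2 * sqNorm z ^ 1) + 4 * s ^ 2 * (star a ⬝ᵥ z).re ^ 2) +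
      (4 * s ^ 3 * ((star a ⬝ᵥ z).re * sqNorm z) + s ^ 4 * sqNorm z ^ 2) := by
  rw [sqNorm_add_smul]
  ring

lemma integrable_sqNorm_sq_noncentral :
    Integrable (fun z => sqNorm (a + (s : ℂ) • z) ^ 2) (cGaussian (Fin (n + 1))) := by
  simp only [sq_sqNorm_add_smul]
  exact ((((integrable_const _).add ((integrable_re a).const_mul _)).add
    ((integrable_sqNorm_pow n 1).const_mul _)).add ((integrable_re_sq a).const_mul _)).add
    (((integrable_re_mul_sqNorm a).const_mul _).add ((integrable_sqNorm_pow n 2).const_mul _))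

lemma integral_sqNorm_sq_noncentral :
    ∫ z, sqNorm (a + (s : ℂ) • z) ^ 2 ∂(cGaussian (Fin (n + 1))) =
      sqNorm a ^ 2 + 2 * sqNorm a * s ^ 2 * (n + 2) + s ^ 4 * ((n + 1) * (n + 2)) := by
  simp only [sq_sqNorm_add_smul]
  have i1 := (integrable_const (μ := cGaussian (Fin (n + 1))) (sqNorm a ^ 2)).add
    ((integrable_re a).const_mul (4 * sqNorm a * s))
  have i2 := (integrable_sqNorm_pow n 1).const_mul (2 * sqNorm a * s ^ 2)
  have i3 := (integrable_re_sq a).const_mul (4 * s ^ 2)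
  have i4 := (integrable_re_mul_sqNorm a).const_mul (4 * s ^ 3)
  have i5 := (integrable_sqNorm_pow n 2).const_mul (s ^ 4)
  refine (integral_add ((i1.add i2).add i3) (i4.add i5)).trans ?_
  rw [integral_add' (i1.add i2) i3, integral_add' i1 i2, integral_add' i4 i5,
    integral_add' (integrable_const _) ((integrable_re a).const_mul _)]
  simp only [integral_const_mul, integral_re_eq_zero, integral_re_mul_sqNorm, integral_re_sq,
    integral_sqNorm_pow]
  have : (n.factorial : ℝ) ≠ 0 := by positivity
  simp only [integral_const, probReal_univ, one_smul, Nat.factorial_succ]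
  push_cast
  field_simp
  ring

end Noncentral

/-! ### The received signal and the jamming channel -/

/-- The image of a Gaussian matrix under a unit vector is a Gaussian vector. -/
lemma measurePreserving_signal {m k : ℕ} (w : Fin k → ℂ) (hw : sqNorm w = 1) :
    MeasurePreserving (fun (z : Fin m × Fin k → ℂ) => (Matrix.of fun i j => z (i, j)) *ᵥ w)
      (cGaussian (Fin m × Fin k)) (cGaussian (Fin m)) := by
  let A : Matrix (Fin m) (Fin m × Fin k) ℂ := Matrix.of fun i p => if i = p.1 then w p.2 else 0
  have hA : A * Aᴴ = 1 := by
    ext i i'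
    rw [Matrix.mul_apply, Fintype.sum_prod_type]
    simp only [A, Matrix.conjTranspose_apply, Matrix.of_apply, Matrix.one_apply]
    by_cases h : i = i'
    · subst h
      have h1 := star_dotProduct_self w
      rw [hw, dotProduct_comm] at h1
      simpa [dotProduct, Finset.sum_comm (s := (Finset.univ : Finset (Fin m)))] using h1
    · have : ∀ x : Fin m, ¬ (i = x ∧ i' = x) := fun x hx => h (hx.1.trans hx.2.symm)
      simp only [h, if_false]
      refine Finset.sum_eq_zero fun x _ => Finset.sum_eq_zero fun y _ => ?_
      by_cases hx : i = x
      · have hx' : i' ≠ x := fun hx' => this x ⟨hx, hx'⟩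
        simp [hx']
      · simp [hx]
  convert measurePreserving_mulVec A hA using 2 with z
  funext i
  simp only [Matrix.mulVec, dotProduct, A, Matrix.of_apply, Fintype.sum_prod_type]
  rw [Finset.sum_eq_single i (fun x _ hx => by simp [Ne.symm hx]) (by simp)]
  simp [mul_comm]

/-- The columns of the product of a Gaussian matrix and a matrix with orthonormal columns are
independent Gaussian vectors. -/
lemma measurePreserving_jamming {m k N : ℕ} (W : Matrix (Fin k) (Fin N) ℂ) (hW : Wᴴ * W = 1) :
    MeasurePreserving (fun (z : Fin m × Fin k → ℂ) j i =>
      ((Matrix.of fun i j => z (i, j) : Matrix (Fin m) (Fin k) ℂ) * W) i j)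
      (cGaussian (Fin m × Fin k)) (cGaussianColumns N (Fin m)) := by
  let A : Matrix (Fin N × Fin m) (Fin m × Fin k) ℂ :=
    Matrix.of fun q p => if q.2 = p.1 then W p.2 q.1 else 0
  have hA : A * Aᴴ = 1 := by
    ext q q'
    rw [Matrix.mul_apply, Fintype.sum_prod_type]
    simp only [A, Matrix.conjTranspose_apply, Matrix.of_apply, Matrix.one_apply]
    rw [Finset.sum_eq_single q.2 (fun x _ hx => by simp [Ne.symm hx]) (by simp)]
    by_cases h : q'.2 = q.2
    · have h1 := congrFun (congrFun hW q'.1) q.1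
      rw [Matrix.mul_apply] at h1
      simp only [Matrix.conjTranspose_apply, Matrix.one_apply] at h1
      have h2 : (q = q') ↔ (q'.1 = q.1) := by
        rw [Prod.ext_iff]
        exact ⟨fun h => h.1.symm, fun h' => ⟨h'.symm, h.symm⟩⟩
      simp only [h, if_true, h2]
      rw [← h1]
      exact Finset.sum_congr rfl fun x _ => mul_comm _ _
    · have h2 : q ≠ q' := fun h' => h (by rw [h'])
      simp [h, h2]
  have hcurry : MeasurePreserving (MeasurableEquiv.curry (Fin N) (Fin m) ℂ)
      (cGaussian (Fin N × Fin m)) (cGaussianColumns N (Fin m)) := by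
    refine ⟨MeasurableEquiv.measurable _, ?_⟩
    have := Measure.infinitePi_map_curry (ι := Fin N) (κ := Fin m) (X := ℂ)
      fun _ _ => stdComplexGaussian
    simp only [Measure.infinitePi_eq_pi] at this
    exact this
  convert hcurry.comp (measurePreserving_mulVec A hA) using 2 with z
  funext j i
  simp only [Function.comp_apply, MeasurableEquiv.coe_curry, Function.curry_apply, Matrix.mulVec,
    dotProduct, A, Matrix.of_apply, Fintype.sum_prod_type]
  rw [Finset.sum_eq_single i (fun x _ hx => by simp [Ne.symm hx]) (by simp), Matrix.mul_apply]
  simp [mul_comm]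

/-- The scattered signal `Gaer w` and the columns of `Gjer W` are independent families of standard
complex Gaussian vectors. -/
lemma hasLaw_signal_jamming {Na Nj m N : ℕ} {Ω : Type*} [MeasurableSpace Ω] {P : Measure Ω}
    [IsProbabilityMeasure P]
    {Gaer : Ω → Matrix (Fin m) (Fin Na) ℂ} {Gjer : Ω → Matrix (Fin m) (Fin Nj) ℂ}
    (hGaer : ∀ i k, HasLaw (fun ω => Gaer ω i k) stdComplexGaussian P)
    (hGjer : ∀ i k, HasLaw (fun ω => Gjer ω i k) stdComplexGaussian P)
    (hindep : iIndepFun (fun (s : (Fin m × Fin Na) ⊕ (Fin m × Fin Nj)) (ω : Ω) =>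
      Sum.elim (fun p => Gaer ω p.1 p.2) (fun p => Gjer ω p.1 p.2) s) P)
    (w : Fin Na → ℂ) (hw : sqNorm w = 1) (W : Matrix (Fin Nj) (Fin N) ℂ) (hW : Wᴴ * W = 1) :
    HasLaw (fun ω => (Gaer ω *ᵥ w, fun (j : Fin N) i => (Gjer ω * W) i j))
      ((cGaussian (Fin m)).prod (cGaussianColumns N (Fin m))) P := by
  have h1 : HasLaw (fun ω (s : (Fin m × Fin Na) ⊕ (Fin m × Fin Nj)) =>
      Sum.elim (fun p => Gaer ω p.1 p.2) (fun p => Gjer ω p.1 p.2) s)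
      (Measure.pi fun _ => stdComplexGaussian) P := by
    refine iIndepFun.hasLaw_pi (fun s => ?_) hindep
    cases s with
    | inl p => exact hGaer p.1 p.2
    | inr p => exact hGjer p.1 p.2
  have h2 := measurePreserving_sumPiEquivProdPi
    (fun _ : (Fin m × Fin Na) ⊕ (Fin m × Fin Nj) => stdComplexGaussian)
  have h3 := (measurePreserving_signal (m := m) w hw).prod (measurePreserving_jamming (m := m) W hW)
  have h4 := h3.comp h2
  exact (h4.hasLaw).comp h1

/-- The line-of-sight part of the signal `G_ae w` received by Eve. -/
def losSignal {Na Nj Ne : ℕ} (C : WiretapChannel Na Nj Ne) (w : EuclideanSpace ℂ (Fin Na)) :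
    Fin Ne → ℂ :=
  (Real.sqrt (C.Kae / (1 + C.Kae)) : ℂ) • (C.Gaeo *ᵥ w.ofLp)

/-- Without a line of sight from the jammer, Eve's SINR is a quadratic form in the inverse of the
interference matrix of the jamming columns. -/
lemma gammaE_eq_sinrForm {Na Nj Ne : ℕ} (C : WiretapChannel Na Nj Ne) (hKje : C.Kje = 0)
    (w : EuclideanSpace ℂ (Fin Na)) (Ga : Matrix (Fin Ne) (Fin Na) ℂ)
    (Gj : Matrix (Fin Ne) (Fin Nj) ℂ) :
    C.gammaE w Ga Gj = C.snrAE * sinrForm C.kappa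
      (losSignal C w + (Real.sqrt (1 / (1 + C.Kae)) : ℂ) • (Ga *ᵥ w.ofLp),
        fun j i => (Gj * C.WAN) i j) := by
  have hx : ricianMatrix C.Kae C.Gaeo Ga *ᵥ w.ofLp =
      losSignal C w + (Real.sqrt (1 / (1 + C.Kae)) : ℂ) • (Ga *ᵥ w.ofLp) := by
    rw [ricianMatrix, Matrix.add_mulVec, Matrix.smul_mulVec, Matrix.smul_mulVec, losSignal]
  have hG : ricianMatrix C.Kje C.Gjeo Gj = Gj := by
    rw [ricianMatrix, hKje]
    simp
  have hM : C.M Gj = interference C.kappa fun j i => (Gj * C.WAN) i j := by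
    rw [WiretapChannel.M, hG, interference, add_comm, Matrix.mul_assoc, Matrix.mul_assoc,
      ← Matrix.mul_assoc, ← Matrix.conjTranspose_mul]
    congr 2
    ext i i'
    simp only [Matrix.conjTranspose_mul, Matrix.mul_apply, Matrix.conjTranspose_apply,
      Matrix.sum_apply, Matrix.vecMulVec_apply, Pi.star_apply, star_sum, star_mul']
    exact Finset.sum_congr rfl fun j _ => congrArg _ (Finset.sum_congr rfl fun x _ => mul_comm _ _)
  rw [WiretapChannel.gammaE, hx, hM, sinrForm]

lemma sqNorm_losSignal {Na Nj Ne : ℕ} (C : WiretapChannel Na Nj Ne)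
    (w : EuclideanSpace ℂ (Fin Na)) :
    sqNorm (losSignal C w) =
      C.Kae / (1 + C.Kae) * ‖WithLp.toLp 2 (C.Gaeo *ᵥ w.ofLp)‖ ^ 2 := by
  have hK := C.Kae_nonneg
  rw [sqNorm_eq_norm_toLp, losSignal, WithLp.toLp_smul, norm_smul, mul_pow, Complex.norm_real,
    Real.norm_eq_abs, sq_abs, Real.sq_sqrt (by positivity)]

/-- Second moment of the received signal in terms of `φ₁`. -/
lemma phi_one {Na Nj n : ℕ} (C : WiretapChannel Na Nj (n + 1)) (w : EuclideanSpace ℂ (Fin Na)) :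
    C.phi w 1 * (n + 1) =
      sqNorm (losSignal C w) + Real.sqrt (1 / (1 + C.Kae)) ^ 2 * (n + 1) := by
  have hK := C.Kae_nonneg
  have hn : (n : ℝ) + 1 ≠ 0 := by positivity
  have hΓ : Real.Gamma ((n : ℝ) + 1) ≠ 0 := (Real.Gamma_pos_of_pos (by positivity)).ne'
  rw [sqNorm_losSignal, Real.sq_sqrt (by positivity), WiretapChannel.phi]
  simp only [Finset.sum_range_succ, Finset.sum_range_zero, Nat.choose_zero_right, Nat.choose_self,
    Nat.cast_add, Nat.cast_one, Nat.cast_zero, add_zero, Real.Gamma_add_one hn]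
  have h1K : 1 + C.Kae ≠ 0 := by positivity
  field_simp
  ring

/-- Fourth moment of the received signal in terms of `φ₂`. -/
lemma phi_two {Na Nj n : ℕ} (C : WiretapChannel Na Nj (n + 1)) (w : EuclideanSpace ℂ (Fin Na)) :
    C.phi w 2 * ((n + 1) * (n + 2)) = sqNorm (losSignal C w) ^ 2 +
      2 * sqNorm (losSignal C w) * Real.sqrt (1 / (1 + C.Kae)) ^ 2 * (n + 2) +
        Real.sqrt (1 / (1 + C.Kae)) ^ 4 * ((n + 1) * (n + 2)) := by
  have hK := C.Kae_nonneg
  have hn : (n : ℝ) + 1 ≠ 0 := by positivity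
  have hn2 : (n : ℝ) + 2 ≠ 0 := by positivity
  have hΓ : Real.Gamma ((n : ℝ) + 1) ≠ 0 := (Real.Gamma_pos_of_pos (by positivity)).ne'
  have hΓ2 : Real.Gamma ((n : ℝ) + 1 + 2) = (n + 2) * ((n + 1) * Real.Gamma (n + 1)) := by
    rw [show (n : ℝ) + 1 + 2 = (n + 1 + 1) + 1 by ring, Real.Gamma_add_one (by positivity),
      Real.Gamma_add_one hn]
    ring
  rw [show Real.sqrt (1 / (1 + C.Kae)) ^ 4 = (Real.sqrt (1 / (1 + C.Kae)) ^ 2) ^ 2 by ring,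
    sqNorm_losSignal, Real.sq_sqrt (by positivity), WiretapChannel.phi]
  simp only [Finset.sum_range_succ, Finset.sum_range_zero, Nat.choose_zero_right, Nat.choose_self,
    Nat.choose_one_right, Nat.cast_ofNat,
    Nat.cast_add, Nat.cast_one, Nat.cast_zero, add_zero, Real.Gamma_add_one hn, hΓ2]
  have h1K : 1 + C.Kae ≠ 0 := by positivity
  field_simp
  ring

/-! ### Moments and outage for gamma laws -/

/-- Multiplying a gamma density by the variable raises the shape by one. -/
lemma mul_gammaPDFReal {a r : ℝ} (ha : 0 < a) (hr : 0 < r) (x : ℝ) :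
    gammaPDFReal a r x * x = a / r * gammaPDFReal (a + 1) r x := by
  unfold gammaPDFReal
  split_ifs with hx
  · have hΓ := (Real.Gamma_pos_of_pos ha).ne'
    rcases hx.eq_or_lt with rfl | hx
    · simp [ha.ne']
    · rw [Real.Gamma_add_one ha.ne', Real.rpow_add_one hr.ne', add_sub_cancel_right,
        show x ^ a = x ^ (a - 1) * x by rw [← Real.rpow_add_one hx.ne', sub_add_cancel]]
      field_simp
  · simp

lemma measurable_gammaPDF (a r : ℝ) : Measurable (gammaPDF a r) :=
  (measurable_gammaPDFReal a r).ennreal_ofReal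

lemma integral_gammaMeasure {a r : ℝ} (ha : 0 < a) (hr : 0 < r) (f : ℝ → ℝ) :
    ∫ x, f x ∂(gammaMeasure a r) = ∫ x, gammaPDFReal a r x * f x := by
  rw [gammaMeasure, integral_withDensity_eq_integral_toReal_smul
    (measurable_gammaPDF a r) (ae_of_all _ fun x => ENNReal.ofReal_lt_top)]
  simp [gammaPDF, ENNReal.toReal_ofReal (gammaPDFReal_nonneg ha hr _)]

lemma integrable_gammaMeasure_iff {a r : ℝ} (ha : 0 < a) (hr : 0 < r) (f : ℝ → ℝ) :
    Integrable f (gammaMeasure a r) ↔ Integrable fun x => gammaPDFReal a r x * f x := by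
  rw [gammaMeasure, integrable_withDensity_iff_integrable_smul'
    (measurable_gammaPDF a r) (ae_of_all _ fun x => ENNReal.ofReal_lt_top)]
  simp [gammaPDF, ENNReal.toReal_ofReal (gammaPDFReal_nonneg ha hr _)]

lemma integral_pow_succ_gammaMeasure {a r : ℝ} (ha : 0 < a) (hr : 0 < r) (k : ℕ) :
    ∫ x, x ^ (k + 1) ∂(gammaMeasure a r) = a / r * ∫ x, x ^ k ∂(gammaMeasure (a + 1) r) := by
  rw [integral_gammaMeasure ha hr, integral_gammaMeasure (by positivity) hr, ← integral_const_mul]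
  congr 1
  funext x
  rw [pow_succ', ← mul_assoc, mul_gammaPDFReal ha hr, mul_assoc]

lemma integrable_pow_gammaMeasure {a r : ℝ} (ha : 0 < a) (hr : 0 < r) (k : ℕ) :
    Integrable (fun x => x ^ k) (gammaMeasure a r) := by
  induction k generalizing a with
  | zero =>
    have := isProbabilityMeasure_gammaMeasure ha hr
    simp
  | succ k ih =>
    rw [integrable_gammaMeasure_iff ha hr]
    have h := (integrable_gammaMeasure_iff (by positivity) hr _).mp
      (ih (a := a + 1) (by positivity))
    refine (h.const_mul (a / r)).congr (ae_of_all _ fun x => ?_)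
    simp only
    rw [pow_succ', ← mul_assoc, ← mul_assoc, mul_gammaPDFReal ha hr]

lemma integral_gammaLaw {a b : ℝ} (ha : 0 < a) (hb : 0 < b) :
    ∫ x, x ∂(gammaLaw a b) = a * b := by
  have := isProbabilityMeasure_gammaMeasure (a := a + 1) (by positivity) (inv_pos.mpr hb)
  have h := integral_pow_succ_gammaMeasure ha (inv_pos.mpr hb) 0
  simpa [gammaLaw] using h

lemma variance_gammaLaw {a b : ℝ} (ha : 0 < a) (hb : 0 < b) :
    variance (fun x : ℝ => x) (gammaLaw a b) = a * b ^ 2 := by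
  have hr := inv_pos.mpr hb
  have : IsProbabilityMeasure (gammaLaw a b) := isProbabilityMeasure_gammaMeasure ha hr
  have hm : MemLp (fun x : ℝ => x) 2 (gammaLaw a b) :=
    (memLp_two_iff_integrable_sq measurable_id.aestronglyMeasurable).mpr
      (integrable_pow_gammaMeasure ha hr 2)
  have h2 : ∫ x, x ^ 2 ∂(gammaLaw a b) = a * b * ((a + 1) * b) := by
    have h := integral_pow_succ_gammaMeasure ha hr 1
    simp only [pow_one] at h
    rw [gammaLaw, h, ← integral_gammaLaw (a := a + 1) (by positivity) hb, gammaLaw, div_inv_eq_mul]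
  rw [variance_eq_sub hm, integral_gammaLaw ha hb]
  simp only [Pi.pow_apply]
  rw [h2]
  ring

lemma ae_nonneg_gammaLaw (a b : ℝ) : ∀ᵐ x ∂(gammaLaw a b), 0 ≤ x := by
  rw [gammaLaw, gammaMeasure,
    ae_withDensity_iff (measurable_gammaPDF a b⁻¹)]
  refine ae_of_all _ fun x hx => ?_
  by_contra h
  exact hx (gammaPDF_of_neg (not_le.mp h))

/-- A gamma law is determined by its mean and its variance. -/
lemma gammaMatches_iff {Ω : Type*} [MeasurableSpace Ω] {P : Measure Ω} {X : Ω → ℝ} {m v : ℝ}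
    (hm : ∫ ω, X ω ∂P = m) (hv : variance X P = v) (hm0 : 0 < m) (hv0 : 0 < v)
    {a b : ℝ} (ha : 0 < a) (hb : 0 < b) :
    GammaMatches a b X P ↔ a = m ^ 2 / v ∧ b = v / m := by
  rw [GammaMatches, integral_gammaLaw ha hb, variance_gammaLaw ha hb, hm, hv]
  constructor
  · rintro ⟨rfl, rfl⟩
    constructor <;> field_simp
  · rintro ⟨rfl, rfl⟩
    constructor <;> field_simp

lemma lowerIncGamma_of_nonpos (a : ℝ) {x : ℝ} (hx : x ≤ 0) : lowerIncGamma a x = 0 := by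
  simp [lowerIncGamma, Ioc_eq_empty (not_lt.mpr hx)]

lemma cdf_gammaLaw {a b : ℝ} (ha : 0 < a) (hb : 0 < b) (x : ℝ) :
    cdf (gammaLaw a b) x = lowerIncGamma a (x / b) / Real.Gamma a := by
  have hr := inv_pos.mpr hb
  rw [gammaLaw, cdf_gammaMeasure_eq_integral ha hr]
  rcases le_or_gt x 0 with hx | hx
  · rw [lowerIncGamma_of_nonpos a (div_nonpos_of_nonpos_of_nonneg hx hb.le), zero_div,
      integral_Iic_eq_integral_Iio]
    exact setIntegral_eq_zero_of_forall_eq_zero fun t (ht : t < x) =>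
      if_neg (not_le.mpr (ht.trans_le hx))
  · have hint : Integrable (gammaPDFReal a b⁻¹) := by
      simpa using (integrable_gammaMeasure_iff ha hr _).mp (integrable_pow_gammaMeasure ha hr 0)
    have hIic : ∫ t in Iic 0, gammaPDFReal a b⁻¹ t = 0 := by
      rw [integral_Iic_eq_integral_Iio]
      exact setIntegral_eq_zero_of_forall_eq_zero fun t (ht : t < 0) => if_neg (not_le.mpr ht)
    have hsplit := intervalIntegral.integral_Iic_sub_Iic (μ := volume) (a := 0) (b := x)
      hint.integrableOn hint.integrableOn
    rw [hIic, sub_zero] at hsplit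
    have hsub := intervalIntegral.integral_comp_div (a := 0) (b := x)
      (fun t => Real.exp (-t) * t ^ (a - 1)) hb.ne'
    rw [zero_div, intervalIntegral.integral_of_le (a := 0) (b := x / b) (by positivity),
      ← lowerIncGamma, smul_eq_mul] at hsub
    rw [hsplit, eq_div_iff (Real.Gamma_pos_of_pos ha).ne', ← mul_right_inj' hb.ne', ← hsub,
      ← intervalIntegral.integral_mul_const, ← intervalIntegral.integral_const_mul]
    refine intervalIntegral.integral_congr fun t ht => ?_
    rw [uIcc_of_le hx.le] at ht
    simp only [gammaPDFReal, if_pos ht.1]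
    rw [Real.div_rpow ht.1 hb.le, Real.rpow_sub_one hb.ne', Real.inv_rpow hb.le,
      show b⁻¹ * t = t / b by ring]
    have hΓ := (Real.Gamma_pos_of_pos ha).ne'
    field_simp

/-! ### Secrecy outage -/

/-- In the branch `γb ≤ γe`, where the rate is `0`, both sides hold. -/
lemma secrecyRate_lt_iff {γb γe Rs : ℝ} (hb : 0 ≤ γb) (he : 0 ≤ γe) (hR : 0 < Rs) :
    secrecyRate γb γe < Rs ↔ 2 ^ (-Rs) * (1 + γb) - 1 < γe := by
  have h2 : (0 : ℝ) < 2 ^ Rs := by positivity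
  rw [secrecyRate, Real.rpow_neg (by norm_num), sub_lt_iff_lt_add', inv_mul_lt_iff₀ h2]
  split_ifs with h
  · rw [← Real.logb_div (by positivity) (by positivity),
      Real.logb_lt_iff_lt_rpow (by norm_num) (by positivity), div_lt_iff₀ (by positivity)]
  · have h1 : (1 : ℝ) < 2 ^ Rs := Real.one_lt_rpow (by norm_num) hR
    simp only [hR, true_iff]
    nlinarith

lemma secrecyOutage_eq {Ω : Type*} [MeasurableSpace Ω] {P : Measure Ω} {X : Ω → ℝ}
    (hX : ∀ᵐ ω ∂P, 0 ≤ X ω) {γb Rs : ℝ} (hb : 0 ≤ γb) (hR : 0 < Rs) :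
    secrecyOutage γb Rs X P = P.real {ω | 2 ^ (-Rs) * (1 + γb) - 1 < X ω} := by
  refine measureReal_congr ?_
  filter_upwards [hX] with ω hω
  exact propext (secrecyRate_lt_iff hb hω hR)

lemma secrecyOutage_gammaLaw {a b : ℝ} (ha : 0 < a) (hb : 0 < b) {γb Rs : ℝ} (hγ : 0 ≤ γb)
    (hR : 0 < Rs) : secrecyOutage γb Rs (fun x : ℝ => x) (gammaLaw a b) =
      1 - lowerIncGamma a ((2 ^ (-Rs) * (1 + γb) - 1) / b) / Real.Gamma a := by
  have : IsProbabilityMeasure (gammaLaw a b) :=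
    isProbabilityMeasure_gammaMeasure ha (inv_pos.mpr hb)
  rw [secrecyOutage_eq (ae_nonneg_gammaLaw a b) hγ hR, ← cdf_gammaLaw ha hb, cdf_eq_real,
    ← probReal_compl_eq_one_sub measurableSet_Iic, compl_Iic]
  rfl

/-! ### The beamformer -/

lemma norm_beamformer {Na Nj Ne : ℕ} (C : WiretapChannel Na Nj Ne) {τ : ℝ}
    (hτ : τ ∈ Icc (0 : ℝ) 1) (h1 : C.nullComponent ≠ 0) (h2 : C.losComponent ≠ 0) :
    ‖C.beamformer τ‖ = 1 := by
  have horth : inner ℂ C.nullComponent C.losComponent = 0 :=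
    Submodule.inner_left_of_mem_orthogonal (K := C.losSpace)
      (Submodule.starProjection_apply_mem _ _) (Submodule.starProjection_apply_mem _ _)
  have h := norm_add_sq_eq_norm_sq_add_norm_sq_of_inner_eq_zero (𝕜 := ℂ)
    ((Real.sqrt τ : ℂ) • (((‖C.nullComponent‖⁻¹ : ℝ) : ℂ) • C.nullComponent))
    ((Real.sqrt (1 - τ) : ℂ) • (((‖C.losComponent‖⁻¹ : ℝ) : ℂ) • C.losComponent))
    (by simp only [inner_smul_left, inner_smul_right, horth, mul_zero])
  have hn1 := norm_ne_zero_iff.mpr h1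
  have hn2 := norm_ne_zero_iff.mpr h2
  simp only [norm_smul, Complex.norm_real, norm_inv, abs_norm, Real.norm_eq_abs,
    abs_of_nonneg (Real.sqrt_nonneg _), inv_mul_cancel₀ hn1, inv_mul_cancel₀ hn2, mul_one,
    Real.mul_self_sqrt hτ.1, Real.mul_self_sqrt (sub_nonneg.mpr hτ.2)] at h
  rw [add_sub_cancel, ← WiretapChannel.beamformer, ← sq] at h
  exact (pow_eq_one_iff_of_nonneg (norm_nonneg _) two_ne_zero).mp h

/-! ### The moments of Eve's SINR -/

section SINR

variable {Na Nj n : ℕ}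

lemma snrAE_pos {Ne : ℕ} (C : WiretapChannel Na Nj Ne) : 0 < C.snrAE := by
  have h1 := C.Pa_pos
  have h2 := Real.rpow_pos_of_pos C.dae_pos (-C.ηae)
  have h3 := C.σe_pos
  unfold WiretapChannel.snrAE
  positivity

lemma gammaB_nonneg {Ne : ℕ} (C : WiretapChannel Na Nj Ne) (w : EuclideanSpace ℂ (Fin Na)) :
    0 ≤ C.gammaB w := by
  have h1 := C.Pa_pos
  have h2 := Real.rpow_pos_of_pos C.dab_pos (-C.ηab)
  have h3 := C.σb_pos
  unfold WiretapChannel.gammaB WiretapChannel.snrAB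
  positivity

lemma gammaE_nonneg {Ne : ℕ} (hNj : 2 ≤ Nj) (C : WiretapChannel Na Nj Ne) (hKje : C.Kje = 0)
    (w : EuclideanSpace ℂ (Fin Na)) (Ga : Matrix (Fin Ne) (Fin Na) ℂ)
    (Gj : Matrix (Fin Ne) (Fin Nj) ℂ) : 0 ≤ C.gammaE w Ga Gj := by
  rw [gammaE_eq_sinrForm C hKje]
  exact mul_nonneg (snrAE_pos C).le (sinrForm_nonneg (kappa_pos hNj C).le _)

/-- The law of the signal received by Eve: a noncentral Gaussian vector. -/
def signalLaw {Ne : ℕ} (C : WiretapChannel Na Nj Ne) (w : EuclideanSpace ℂ (Fin Na)) :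
    Measure (Fin Ne → ℂ) :=
  (cGaussian (Fin Ne)).map
    fun z => losSignal C w + (Real.sqrt (1 / (1 + C.Kae)) : ℂ) • z

lemma measurable_affine {ι : Type*} (a : ι → ℂ) (c : ℂ) :
    Measurable fun z : ι → ℂ => a + c • z := by
  fun_prop

instance {Ne : ℕ} (C : WiretapChannel Na Nj Ne) (w : EuclideanSpace ℂ (Fin Na)) :
    IsProbabilityMeasure (signalLaw C w) :=
  Measure.isProbabilityMeasure_map (measurable_affine _ _).aemeasurable

lemma integrable_sqNorm_signalLaw (C : WiretapChannel Na Nj (n + 1))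
    (w : EuclideanSpace ℂ (Fin Na)) :
    Integrable (fun x => sqNorm x ^ 1) (signalLaw C w) ∧
      Integrable (fun x => sqNorm x ^ 2) (signalLaw C w) := by
  constructor <;> rw [signalLaw, integrable_map_measure
    (measurable_sqNorm.pow_const _).aestronglyMeasurable (measurable_affine _ _).aemeasurable]
  · exact integrable_sqNorm_noncentral _ _
  · exact integrable_sqNorm_sq_noncentral _ _

lemma integral_sqNorm_signalLaw (C : WiretapChannel Na Nj (n + 1))
    (w : EuclideanSpace ℂ (Fin Na)) :
    ∫ x, sqNorm x ^ 1 ∂(signalLaw C w) = C.phi w 1 * (n + 1) := by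
  rw [signalLaw, integral_map (measurable_affine _ _).aemeasurable
    (measurable_sqNorm.pow_const _).aestronglyMeasurable, integral_sqNorm_noncentral, phi_one]

lemma integral_sqNorm_sq_signalLaw (C : WiretapChannel Na Nj (n + 1))
    (w : EuclideanSpace ℂ (Fin Na)) :
    ∫ x, sqNorm x ^ 2 ∂(signalLaw C w) = C.phi w 2 * ((n + 1) * (n + 2)) := by
  rw [signalLaw, integral_map (measurable_affine _ _).aemeasurable
    (measurable_sqNorm.pow_const _).aestronglyMeasurable, integral_sqNorm_sq_noncentral, phi_two]

/-- `ϑ_l` is the `l`-th moment of `zᴴ M⁻¹ z`; it splits into the moment of `‖z‖²` and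
`invMoment`. -/
lemma vartheta_one (hNj : 2 ≤ Nj) (C : WiretapChannel Na Nj (n + 1)) :
    C.vartheta 1 = (n + 1) * invMoment C.kappa (Nj - 1) n 1 := by
  have h := invMoment_eq hNj C 0
  rw [zero_add, Nat.factorial_succ] at h
  rw [h]
  push_cast
  field_simp

lemma vartheta_two (hNj : 2 ≤ Nj) (C : WiretapChannel Na Nj (n + 1)) :
    C.vartheta 2 = (n + 1) * (n + 2) * invMoment C.kappa (Nj - 1) n 2 := by
  have h := invMoment_eq hNj C 1
  rw [show n + (1 + 1) = n + 1 + 1 from rfl, Nat.factorial_succ, Nat.factorial_succ] at h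
  rw [show (2 : ℕ) = 1 + 1 from rfl, h]
  push_cast
  field_simp
  ring

lemma phi_one_pos (C : WiretapChannel Na Nj (n + 1)) (w : EuclideanSpace ℂ (Fin Na)) :
    0 < C.phi w 1 := by
  have hK := C.Kae_nonneg
  have h := phi_one C w
  have hA := sqNorm_nonneg (losSignal C w)
  have hs : 0 < Real.sqrt (1 / (1 + C.Kae)) := Real.sqrt_pos.mpr (by positivity)
  have hn : (0 : ℝ) < n + 1 := by positivity
  refine pos_of_mul_pos_left (b := (n : ℝ) + 1) ?_ hn.le
  rw [h]
  positivity

/-- The received power has positive variance. -/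
lemma sq_phi_one_lt (C : WiretapChannel Na Nj (n + 1)) (w : EuclideanSpace ℂ (Fin Na)) :
    (C.phi w 1 * (n + 1)) ^ 2 < C.phi w 2 * ((n + 1) * (n + 2)) := by
  have hK := C.Kae_nonneg
  have hA := sqNorm_nonneg (losSignal C w)
  have hs : 0 < Real.sqrt (1 / (1 + C.Kae)) := Real.sqrt_pos.mpr (by positivity)
  rw [phi_one, phi_two]
  have h1 : 0 < Real.sqrt (1 / (1 + C.Kae)) ^ 4 * ((n : ℝ) + 1) := by positivity
  have h2 : 0 ≤ 2 * sqNorm (losSignal C w) * Real.sqrt (1 / (1 + C.Kae)) ^ 2 := by positivity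
  nlinarith

lemma phi_one_mul_vartheta_one_pos (hNj : 2 ≤ Nj) (C : WiretapChannel Na Nj (n + 1))
    (w : EuclideanSpace ℂ (Fin Na)) : 0 < C.phi w 1 * C.vartheta 1 := by
  have h1 := phi_one_pos C w
  have h2 := invMoment_one_pos hNj C
  rw [vartheta_one hNj]
  positivity

/-- The variance is positive because the received power has positive variance, by `sq_phi_one_lt`,
and the jamming factor has nonnegative variance, by `sq_invMoment_one_le`. -/
lemma variance_factor_pos (hNj : 2 ≤ Nj) (C : WiretapChannel Na Nj (n + 1))
    (w : EuclideanSpace ℂ (Fin Na)) :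
    0 < C.phi w 2 * C.vartheta 2 - C.phi w 1 ^ 2 * C.vartheta 1 ^ 2 := by
  have h1 := sq_phi_one_lt C w
  have h2 := invMoment_one_pos hNj C
  have h3 := sq_invMoment_one_le hNj C
  rw [vartheta_one hNj, vartheta_two hNj, sub_pos]
  calc C.phi w 1 ^ 2 * ((n + 1) * invMoment C.kappa (Nj - 1) n 1) ^ 2
      = (C.phi w 1 * (n + 1)) ^ 2 * invMoment C.kappa (Nj - 1) n 1 ^ 2 := by ring
    _ < C.phi w 2 * ((n + 1) * (n + 2)) * invMoment C.kappa (Nj - 1) n 1 ^ 2 := by gcongr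
    _ ≤ C.phi w 2 * ((n + 1) * (n + 2)) * invMoment C.kappa (Nj - 1) n 2 := by
        gcongr
        exact (sq_nonneg _).trans h1.le
    _ = _ := by ring

variable {Ω : Type*} [MeasurableSpace Ω] {P : Measure Ω}

/-- Eve's SINR has the law of `γ̃_ae xᴴ M⁻¹ x` with `x` noncentral Gaussian and `M` independent of
`x`, so that its moments factor. -/
lemma moments_gammaE (hNj : 2 ≤ Nj) (C : WiretapChannel Na Nj (n + 1)) (hKje : C.Kje = 0)
    [IsProbabilityMeasure P]
    {Gaer : Ω → Matrix (Fin (n + 1)) (Fin Na) ℂ} {Gjer : Ω → Matrix (Fin (n + 1)) (Fin Nj) ℂ}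
    (hGaer : ∀ i k, HasLaw (fun ω => Gaer ω i k) stdComplexGaussian P)
    (hGjer : ∀ i k, HasLaw (fun ω => Gjer ω i k) stdComplexGaussian P)
    (hindep : iIndepFun (fun (s : (Fin (n + 1) × Fin Na) ⊕ (Fin (n + 1) × Fin Nj)) (ω : Ω) =>
      Sum.elim (fun p => Gaer ω p.1 p.2) (fun p => Gjer ω p.1 p.2) s) P)
    {w : EuclideanSpace ℂ (Fin Na)} (hw : ‖w‖ = 1) :
    AEMeasurable (fun ω => C.gammaE w (Gaer ω) (Gjer ω)) P ∧
    ∀ l ∈ ({1, 2} : Finset ℕ), Integrable (fun ω => C.gammaE w (Gaer ω) (Gjer ω) ^ l) P ∧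
      ∫ ω, C.gammaE w (Gaer ω) (Gjer ω) ^ l ∂P = C.snrAE ^ l * C.phi w l * C.vartheta l := by
  have hκ := kappa_pos hNj C
  have hw' : sqNorm w.ofLp = 1 := by
    rw [sqNorm_eq_norm_toLp]
    simp [hw]
  have hmp : MeasurePreserving (fun z : Fin (n + 1) → ℂ =>
      losSignal C w + (Real.sqrt (1 / (1 + C.Kae)) : ℂ) • z) (cGaussian (Fin (n + 1)))
      (signalLaw C w) := ⟨measurable_affine _ _, rfl⟩
  have hid : MeasurePreserving id (cGaussianColumns (Nj - 1) (Fin (n + 1)))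
      (cGaussianColumns (Nj - 1) (Fin (n + 1))) := MeasurePreserving.id _
  have hlaw := (hmp.prod hid).comp_hasLaw
    (hasLaw_signal_jamming hGaer hGjer hindep w.ofLp hw' C.WAN C.WAN_orthonormal)
  have hf : ∀ l, (fun ω => C.gammaE w (Gaer ω) (Gjer ω) ^ l) =
      fun ω => C.snrAE ^ l * (fun p => sinrForm C.kappa p ^ l) ((Prod.map (fun z =>
        losSignal C w + (Real.sqrt (1 / (1 + C.Kae)) : ℂ) • z) id ∘ fun ω =>
          (Gaer ω *ᵥ w.ofLp, fun (j : Fin (Nj - 1)) i => (Gjer ω * C.WAN) i j)) ω) := by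
    intro l
    funext ω
    rw [gammaE_eq_sinrForm C hKje, mul_pow]
    rfl
  have hmeas : ∀ l, Measurable fun p : (Fin (n + 1) → ℂ) × (Fin (Nj - 1) → Fin (n + 1) → ℂ) =>
      sinrForm C.kappa p ^ l := fun l => (measurable_sinrForm hκ.le).pow_const l
  have hint : ∀ l, Integrable (fun x => sqNorm x ^ (l + 1)) (signalLaw C w) →
      Integrable (fun ω => C.gammaE w (Gaer ω) (Gjer ω) ^ (l + 1)) P ∧
      ∫ ω, C.gammaE w (Gaer ω) (Gjer ω) ^ (l + 1) ∂P = C.snrAE ^ (l + 1) *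
        ((∫ x, sqNorm x ^ (l + 1) ∂(signalLaw C w)) * invMoment C.kappa (Nj - 1) n (l + 1)) := by
    intro l hl
    rw [hf]
    constructor
    · refine Integrable.const_mul ?_ _
      have h := integrable_sinrForm_pow hNj C l hl
      rw [← hlaw.map_eq] at h
      exact h.comp_aemeasurable hlaw.aemeasurable
    · rw [integral_const_mul, ← integral_sinrForm_pow hNj C l hl]
      congr 1
      exact hlaw.integral_comp (hmeas _).aestronglyMeasurable
  have hS := integrable_sqNorm_signalLaw C w
  refine ⟨?_, fun l hl => ?_⟩
  · have h := hf 1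
    simp only [pow_one] at h
    rw [h]
    exact ((measurable_sinrForm hκ.le).comp_aemeasurable hlaw.aemeasurable).const_mul C.snrAE
  · rw [Finset.mem_insert, Finset.mem_singleton] at hl
    rcases hl with rfl | rfl
    · refine ⟨(hint 0 hS.1).1, (hint 0 hS.1).2.trans ?_⟩
      rw [zero_add, integral_sqNorm_signalLaw, vartheta_one hNj]
      ring
    · refine ⟨(hint 1 hS.2).1, (hint 1 hS.2).2.trans ?_⟩
      rw [show 1 + 1 = 2 from rfl, integral_sqNorm_sq_signalLaw, vartheta_two hNj]
      ring

end SINR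

end

theorem theorem2 {Na Nj Ne : ℕ} (hNj : 2 ≤ Nj) (hNe : 1 ≤ Ne)
    (C : WiretapChannel Na Nj Ne) (hKje : C.Kje = 0)
    {Ω : Type*} [MeasurableSpace Ω] (P : Measure Ω) [IsProbabilityMeasure P]
    -- the scattered components of the Alice-Eve and the jammer-Eve channels
    (Gaer : Ω → Matrix (Fin Ne) (Fin Na) ℂ) (Gjer : Ω → Matrix (Fin Ne) (Fin Nj) ℂ)
    -- all their entries are independent standard complex Gaussian variables
    (hGaer : ∀ i k, HasLaw (fun ω => Gaer ω i k) stdComplexGaussian P)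
    (hGjer : ∀ i k, HasLaw (fun ω => Gjer ω i k) stdComplexGaussian P)
    (hindep : iIndepFun (fun (s : (Fin Ne × Fin Na) ⊕ (Fin Ne × Fin Nj)) (ω : Ω) =>
      Sum.elim (fun p => Gaer ω p.1 p.2) (fun p => Gjer ω p.1 p.2) s) P) :
    -- the location-based beamformers are unit vectors, so that the rest applies to them
    (∀ τ ∈ Icc (0 : ℝ) 1, C.nullComponent ≠ 0 → C.losComponent ≠ 0 → ‖C.beamformer τ‖ = 1) ∧
    ∀ w : EuclideanSpace ℂ (Fin Na), ‖w‖ = 1 →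
      -- the exact first two moments and the variance of Eve's SINR
      (∀ l ∈ ({1, 2} : Finset ℕ),
        Integrable (fun ω => C.gammaE w (Gaer ω) (Gjer ω) ^ l) P ∧
        ∫ ω, C.gammaE w (Gaer ω) (Gjer ω) ^ l ∂P = C.snrAE ^ l * C.phi w l * C.vartheta l) ∧
      variance (fun ω => C.gammaE w (Gaer ω) (Gjer ω)) P =
        C.snrAE ^ 2 * (C.phi w 2 * C.vartheta 2 - C.phi w 1 ^ 2 * C.vartheta 1 ^ 2) ∧
      0 < C.phi w 1 * C.vartheta 1 ∧
      0 < C.phi w 2 * C.vartheta 2 - C.phi w 1 ^ 2 * C.vartheta 1 ^ 2 ∧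
      -- `α`, `β` are the parameters of the unique gamma law with these first two moments
      0 < C.alpha w ∧ 0 < C.beta w ∧
      (∀ a b : ℝ, 0 < a → 0 < b →
        (GammaMatches a b (fun ω => C.gammaE w (Gaer ω) (Gjer ω)) P ↔
          a = C.alpha w ∧ b = C.beta w)) ∧
      ∀ Rs : ℝ, 0 < Rs →
        -- the exact secrecy outage probability in terms of the law of Eve's SINR
        secrecyOutage (C.gammaB w) Rs (fun ω => C.gammaE w (Gaer ω) (Gjer ω)) P =
          P.real {ω | 2 ^ (-Rs) * (1 + C.gammaB w) - 1 < C.gammaE w (Gaer ω) (Gjer ω)} ∧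
        -- the approximate secrecy outage probability, Eve's SINR having the matched gamma law
        secrecyOutage (C.gammaB w) Rs (fun x : ℝ => x) (gammaLaw (C.alpha w) (C.beta w)) =
          1 - lowerIncGamma (C.alpha w) ((2 ^ (-Rs) * (1 + C.gammaB w) - 1) / C.beta w) /
            Real.Gamma (C.alpha w) := by
  obtain ⟨n, rfl⟩ : ∃ n, Ne = n + 1 := ⟨Ne - 1, by omega⟩
  refine ⟨fun τ hτ h1 h2 => norm_beamformer C hτ h1 h2, fun w hw => ?_⟩
  obtain ⟨hmeas, hmom⟩ := moments_gammaE hNj C hKje hGaer hGjer hindep hw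
  have hsnr := snrAE_pos C
  have hpos := phi_one_mul_vartheta_one_pos hNj C w
  have hvpos := variance_factor_pos hNj C w
  have hmean : ∫ ω, C.gammaE w (Gaer ω) (Gjer ω) ∂P = C.snrAE * (C.phi w 1 * C.vartheta 1) := by
    simpa [mul_assoc] using (hmom 1 (by simp)).2
  have hvar : variance (fun ω => C.gammaE w (Gaer ω) (Gjer ω)) P =
      C.snrAE ^ 2 * (C.phi w 2 * C.vartheta 2 - C.phi w 1 ^ 2 * C.vartheta 1 ^ 2) := by
    rw [variance_eq_sub ((memLp_two_iff_integrable_sq hmeas.aestronglyMeasurable).mpr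
      (hmom 2 (by simp)).1), hmean]
    simp only [Pi.pow_apply]
    rw [(hmom 2 (by simp)).2]
    ring
  have hα : C.alpha w = (C.snrAE * (C.phi w 1 * C.vartheta 1)) ^ 2 /
      (C.snrAE ^ 2 * (C.phi w 2 * C.vartheta 2 - C.phi w 1 ^ 2 * C.vartheta 1 ^ 2)) := by
    rw [WiretapChannel.alpha, mul_pow, mul_pow, mul_div_mul_left _ _ (by positivity)]
  have hβ : C.beta w =
      C.snrAE ^ 2 * (C.phi w 2 * C.vartheta 2 - C.phi w 1 ^ 2 * C.vartheta 1 ^ 2) /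
        (C.snrAE * (C.phi w 1 * C.vartheta 1)) := by
    rw [WiretapChannel.beta, sq C.snrAE, mul_assoc, mul_div_mul_left _ _ hsnr.ne', mul_div_assoc]
  have hαpos : 0 < C.alpha w := by rw [hα]; positivity
  have hβpos : 0 < C.beta w := by rw [hβ]; positivity
  have hγ := gammaB_nonneg C w
  refine ⟨hmom, hvar, hpos, hvpos, hαpos, hβpos, fun a b ha hb => ?_, fun Rs hRs =>
    ⟨secrecyOutage_eq (ae_of_all _ fun ω => gammaE_nonneg hNj C hKje w _ _) hγ hRs,
      secrecyOutage_gammaLaw hαpos hβpos hγ hRs⟩⟩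
  rw [hα, hβ]
  exact gammaMatches_iff hmean hvar (by positivity) (by positivity) ha hb
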